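/- Let $(X,\Phi,Y,\Phi^\vee)$ be a reduced semisimple root datum with a base $\Delta$, and let a group $\Gamma$ act on it by automorphisms preserving $\Delta$. (For a connected semisimple group $G$ over a local field $F$, let $L$ be the completion of the maximal unramified extension of $F$, $S$ a maximal $L$-split torus defined over $F$, and $T$ its centralizer, a maximal torus since $G_L$ is quasi-split. One takes $X=X^*(T)$, $Y=X_*(T)$, the absolute roots and coroots, the base given by a Borel subgroup over $L$ containing $T$, and the inertia group $\Gamma=\mathrm{Gal}(\bar L/L)$.) Let $W_0$ be the group of $\Gamma$-fixed elements of the Weyl group of $\Phi$ (the relative Weyl group $N(L)/T(L)$), let $Y_\Gamma$ be the coinvariants, and let $$\tilde W = Y_\Gamma\rtimes W_0=\{t^\lambda w\;;\;\lambda\in Y_\Gamma,\ w\in W_0\}$$ be the Iwahori–Weyl group, acting by affine transformations on the apartment $V=Y_\Gamma\otimes\mathbb R$ with a special vertex as origin. For $\alpha\in\Phi$ let $\bar\alpha^\vee\in Y_\Gamma$ be the image of $\alpha^\vee$, and let $\beta_\alpha=c_\alpha\sum_{\alpha'\in\Gamma\alpha}\alpha'$, a functional on $Y_\Gamma$, where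 $c_\alpha=1$ if the roots in $\Gamma\alpha$ are pairwise orthogonal and $c_\alpha=2$ otherwise. The affine root hyperplanes are $\{\beta_\alpha=k\}$ with $\alpha\in\Phi$, $k\in\mathbb Z$; the corresponding affine reflections are $t^{k\bar\alpha^\vee}s_\alpha$, where $s_\alpha\in W_0$ acts on $Y_\Gamma$ by $y\mapsto y-\beta_\alpha(y)\bar\alpha^\vee$, and they generate the affine Weyl group $W_a$. The base alcove is $\mathbf a=\{v\;;\;0<\beta_\alpha(v)<1\text{ for all positive }\alpha\}$, $\tilde{\mathbb S}$ is the set of reflections in the walls of $\mathbf a$, and $\Omega$ is the stabilizer of $\mathbf a$ in $\tilde W$, so that $\tilde W=W_a\rtimes\Omega$. The length function and the Bruhat order of the Coxeter group $(W_a,\tilde{\mathbb S})$ are extended to $\tilde W$ as usual: $\ell(w\tau)=\ell(w)$ for $w\in W_a$, $\tau\in\Omega$, and $w\tau\le w'\tau'$ if and only if $\tau=\tau'$ and $w\le w'$. For $\mu\in Y$ with image $\underline\mu\in Y_\Gamma$, put $$\mathrm{Adm}(\mu)=\{w\in\tilde W\;;\;w\le t^{x(\underline\mu)}\text{ for some }x\in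 W_0\}.$$ For $J\subset\tilde{\mathbb S}$ let $W_J\subset\tilde W$ be the subgroup generated by $J$, let ${}^J\tilde W$ be the set of elements of minimal length in their cosets in $W_J\backslash\tilde W$, and put $\mathrm{Adm}^J(\mu)=W_J\,\mathrm{Adm}(\mu)\,W_J$. **Theorem.** Let $\mu\in Y$ be dominant and let $J\subset\tilde{\mathbb S}$ with $W_J$ finite. Then $${}^J\tilde W\cap\mathrm{Adm}^J(\mu)={}^J\tilde W\cap\mathrm{Adm}(\mu).$$ -/

import Mathlib

open scoped TensorProduct Pointwise

noncomputable section

/-- The natural (covariant) representation of the automorphism group of a root datum on the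
cocharacter lattice `Y`. -/
def coweightRep {ι X Y : Type*} [AddCommGroup X] [AddCommGroup Y] (P : RootPairing ι ℤ X Y) :
    Representation ℤ P.Aut Y where
  toFun g := (RootPairing.Equiv.coweightEquiv P P g⁻¹).toLinearMap
  map_one' := by
    ext y
    simp
  map_mul' g h := by
    ext y
    rw [mul_inv_rev]
    rfl

/-- The absolute root datum of a connected semisimple group that is quasi-split over its base
field: a reduced, semisimple root datum (character lattice `X = X^*(T)`, cocharacter lattice
`Y = X_*(T)`, roots and coroots indexed by `ι`), a base (given by a Borel subgroup defined over the
base field), and an action of the Galois group `Γ` of the base field on the root datum which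
preserves that base. -/
structure QuasiSplitRootDatum (ι X Y Γ : Type*) [AddCommGroup X] [AddCommGroup Y] [Group Γ] where
  /-- The absolute root datum. -/
  P : RootPairing ι ℤ X Y
  isReduced : P.IsReduced
  semisimple : ∀ x : X, (∀ i, P.toLinearMap x (P.coroot i) = 0) → x = 0
  /-- The simple roots. -/
  base : P.Base
  /-- The action of the Galois group. -/
  act : Γ →* P.Aut
  act_base : ∀ γ : Γ, ∀ i ∈ base.support,
    RootPairing.Equiv.indexHom P (act γ) i ∈ base.support

namespace QuasiSplitRootDatum

variable {ι X Y Γ : Type*} [AddCommGroup X] [AddCommGroup Y] [Group Γ]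
  (D : QuasiSplitRootDatum ι X Y Γ)

/-- The action of `Γ` on the cocharacter lattice `X_*(T)`. -/
def galRep : Representation ℤ Γ Y := (coweightRep D.P).comp D.act

/-- The subgroup of `X_*(T)` generated by all `γ y - y`. -/
def coinvKer : AddSubgroup Y := AddSubgroup.closure {z | ∃ (γ : Γ) (y : Y), z = D.galRep γ y - y}

/-- The coinvariants `X_*(T)_Γ` (possibly with torsion). -/
abbrev Coinv : Type _ := Y ⧸ D.coinvKer

/-- The projection `X_*(T) → X_*(T)_Γ`. -/
def toCoinv : Y →+ D.Coinv := QuotientAddGroup.mk' D.coinvKer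

/-- The relative Weyl group `W₀ = N(L)/T(L)`: the elements of the absolute Weyl group that are
fixed by `Γ`. -/
def W₀ : Subgroup D.P.Aut := D.P.weylGroup ⊓ Subgroup.centralizer (Set.range D.act)

lemma W₀_comm (w : D.W₀) (γ : Γ) (y : Y) :
    coweightRep D.P w (D.galRep γ y) = D.galRep γ (coweightRep D.P w y) := by
  have h : (w : D.P.Aut) * D.act γ = D.act γ * (w : D.P.Aut) :=
    ((Subgroup.mem_centralizer_iff.mp w.2.2) (D.act γ) ⟨γ, rfl⟩).symm
  change (coweightRep D.P w * coweightRep D.P (D.act γ)) y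
    = (coweightRep D.P (D.act γ) * coweightRep D.P w) y
  rw [← map_mul, ← map_mul, h]

lemma coinvKer_le_comap (w : D.W₀) :
    D.coinvKer ≤ D.coinvKer.comap (coweightRep D.P w).toAddMonoidHom := by
  refine (AddSubgroup.closure_le _).2 ?_
  rintro _ ⟨γ, y, rfl⟩
  refine AddSubgroup.subset_closure ⟨γ, coweightRep D.P w y, ?_⟩
  change coweightRep D.P w (D.galRep γ y - y) = _
  rw [map_sub, D.W₀_comm]

/-- The action of `W₀` on `X_*(T)_Γ`. -/
def weylAct : D.W₀ →* AddMonoid.End D.Coinv where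
  toFun w := QuotientAddGroup.map _ _ (coweightRep D.P w).toAddMonoidHom (D.coinvKer_le_comap w)
  map_one' := by
    ext z
    obtain ⟨y, rfl⟩ := QuotientAddGroup.mk_surjective z
    change D.toCoinv (coweightRep D.P ((1 : D.W₀) : D.P.Aut) y) = D.toCoinv y
    rw [OneMemClass.coe_one, map_one]
    rfl
  map_mul' w w' := by
    ext z
    obtain ⟨y, rfl⟩ := QuotientAddGroup.mk_surjective z
    change D.toCoinv (coweightRep D.P ((w * w' : D.W₀) : D.P.Aut) y) =
      D.toCoinv (coweightRep D.P w (coweightRep D.P w' y))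
    rw [Subgroup.coe_mul, map_mul]
    rfl

/-- The action of `W₀` on `X_*(T)_Γ`, in multiplicative notation. -/
def weylMulAut : D.W₀ →* MulAut (Multiplicative D.Coinv) where
  toFun w :=
    { toFun := fun y => Multiplicative.ofAdd (D.weylAct w y.toAdd)
      invFun := fun y => Multiplicative.ofAdd (D.weylAct w⁻¹ y.toAdd)
      left_inv := fun y => by
        change Multiplicative.ofAdd ((D.weylAct w⁻¹ * D.weylAct w) y.toAdd) = y
        rw [← map_mul, inv_mul_cancel, map_one]
        rfl
      right_inv := fun y => by
        change Multiplicative.ofAdd ((D.weylAct w * D.weylAct w⁻¹) y.toAdd) = y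
        rw [← map_mul, mul_inv_cancel, map_one]
        rfl
      map_mul' := fun y z => by
        rw [toAdd_mul, map_add, ofAdd_add] }
  map_one' := by
    ext y
    change Multiplicative.ofAdd (D.weylAct 1 y.toAdd) = y
    rw [map_one]
    rfl
  map_mul' w w' := by
    ext y
    change Multiplicative.ofAdd (D.weylAct (w * w') y.toAdd) = _
    rw [map_mul]
    rfl

/-- The Iwahori-Weyl group `W̃ = X_*(T)_Γ ⋊ W₀`. -/
abbrev IwahoriWeyl : Type _ := Multiplicative D.Coinv ⋊[D.weylMulAut] D.W₀

/-- The translation element `t^y`, for `y` in `X_*(T)_Γ`. -/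
def t (y : D.Coinv) : D.IwahoriWeyl := SemidirectProduct.inl (Multiplicative.ofAdd y)

/-! ### Affine roots, affine reflections and the apartment -/

/-- The `Γ`-orbit of a root. -/
def orbit (i : ι) : Set ι := Set.range fun γ : Γ => RootPairing.Equiv.indexHom D.P (D.act γ) i

open Classical in
/-- The factor `1` if the roots in the orbit of `i` are pairwise orthogonal, and `2` otherwise (the
orbit is then a union of pairs of roots, each spanning a system of type `A₂`). -/
def orbitFactor (i : ι) : ℤ :=
  if ∀ j ∈ D.orbit i, ∀ k ∈ D.orbit i, j ≠ k → D.P.pairing j k = 0 then 1 else 2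

/-- The sum of the roots in the `Γ`-orbit of `i`, as a functional on `X_*(T)`. -/
def orbitSum [Finite ι] (i : ι) : Y →ₗ[ℤ] ℤ :=
  ∑ j ∈ (Set.toFinite (D.orbit i)).toFinset, D.P.toLinearMap (D.P.root j)

lemma orbitSum_galRep [Finite ι] (i : ι) (γ : Γ) :
    D.orbitSum i ∘ₗ D.galRep γ = D.orbitSum i := by
  ext y
  simp only [orbitSum, LinearMap.comp_apply, LinearMap.sum_apply]
  refine Finset.sum_equiv (RootPairing.Equiv.indexHom D.P (D.act γ⁻¹)) ?_ ?_
  · intro j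
    simp only [Set.Finite.mem_toFinset, orbit, Set.mem_range]
    constructor
    · rintro ⟨δ, rfl⟩
      exact ⟨γ⁻¹ * δ, by simp⟩
    · rintro ⟨δ, h⟩
      refine ⟨γ * δ, ?_⟩
      rw [map_mul, map_mul, Equiv.Perm.mul_apply, h]
      simp
  · intro j _
    have h1 := LinearMap.congr_fun (RootPairing.Hom.weight_coweight_transpose_apply D.P D.P y
      (D.act γ⁻¹).toHom) (D.P.root j)
    have h2 := RootPairing.Hom.root_weightMap_apply D.P D.P j (D.act γ⁻¹).toHom
    change D.P.toLinearMap (D.P.root j) (RootPairing.Equiv.coweightEquiv D.P D.P (D.act γ)⁻¹ y) = _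
    rw [← map_inv]
    change D.P.toLinearMap ((D.act γ⁻¹).toHom.weightMap (D.P.root j)) y
      = D.P.toLinearMap (D.P.root j) ((D.act γ⁻¹).toHom.coweightMap y) at h1
    rw [h2] at h1
    exact h1.symm

/-- The relative root attached to `i`, normalized as in the reduced root system whose affine Weyl
group is that of the quasi-split group: the orbit sum times the orbit factor, as a functional on
`X_*(T)_Γ`. -/
def relRoot [Finite ι] (i : ι) : D.Coinv →+ ℤ :=
  QuotientAddGroup.lift D.coinvKer (D.orbitFactor i • (D.orbitSum i).toAddMonoidHom) (by
    refine (AddSubgroup.closure_le _).2 ?_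
    rintro _ ⟨γ, y, rfl⟩
    have h := LinearMap.congr_fun (D.orbitSum_galRep i γ) y
    simp only [LinearMap.comp_apply] at h
    simp [AddMonoidHom.mem_ker, h])

/-- The relative coroot attached to `i`: the image of the `i`-th coroot in `X_*(T)_Γ`. -/
def relCoroot (i : ι) : D.Coinv := D.toCoinv (D.P.coroot i)

/-- `D.IsReflection i k r`: the element `r` of `W̃` is the affine reflection in the hyperplane
`relRoot i = k`, that is `r = t^{k a} s` with `a = relCoroot i` and `s ∈ W₀` the reflection
`y ↦ y - (relRoot i y) a`. -/
def IsReflection [Finite ι] (i : ι) (k : ℤ) (r : D.IwahoriWeyl) : Prop :=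
  r.left = Multiplicative.ofAdd (k • D.relCoroot i) ∧
    ∀ y : D.Coinv, D.weylAct r.right y = y - D.relRoot i y • D.relCoroot i

/-- The apartment `V = X_*(T)_Γ ⊗ ℝ`, with the chosen special vertex as origin. -/
abbrev Apartment : Type _ := ℝ ⊗[ℤ] D.Coinv

/-- The relative roots as linear functionals on the apartment. -/
def realRoot [Finite ι] (i : ι) : D.Apartment →ₗ[ℝ] ℝ :=
  (TensorProduct.AlgebraTensorModule.rid ℤ ℝ ℝ).toLinearMap ∘ₗ
    (D.relRoot i).toIntLinearMap.baseChange ℝ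

/-- The affine action of `W̃` on the apartment: `t^y w` acts by `v ↦ w v + y`. -/
def apartmentAct (x : D.IwahoriWeyl) (v : D.Apartment) : D.Apartment :=
  (D.weylAct x.right).toIntLinearMap.baseChange ℝ v + (1 : ℝ) ⊗ₜ[ℤ] x.left.toAdd

/-- The affine root hyperplane `relRoot i = k`. -/
def hyperplane [Finite ι] (i : ι) (k : ℤ) : Set D.Apartment := {v | D.realRoot i v = k}

/-- The root with index `i` is positive with respect to the base. -/
def IsPos (i : ι) : Prop := D.P.root i ∈ AddSubmonoid.closure (D.P.root '' D.base.support)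

/-- The base alcove: the alcove in the dominant chamber with the special vertex in its closure. -/
def alcove [Finite ι] : Set D.Apartment :=
  {v | ∀ i, D.IsPos i → 0 < D.realRoot i v ∧ D.realRoot i v < 1}

/-- The closure of the base alcove. -/
def closedAlcove [Finite ι] : Set D.Apartment :=
  {v | ∀ i, D.IsPos i → 0 ≤ D.realRoot i v ∧ D.realRoot i v ≤ 1}

/-- The hyperplane `relRoot i = k` is a wall of the base alcove: some point of it lies in the closed
alcove and on no other affine root hyperplane. -/
def IsWall [Finite ι] (i : ι) (k : ℤ) : Prop :=
  ∃ v ∈ D.hyperplane i k, v ∈ D.closedAlcove ∧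
    ∀ (j : ι) (m : ℤ), v ∈ D.hyperplane j m → D.hyperplane j m = D.hyperplane i k

/-! ### Simple reflections, length, Bruhat order -/

/-- The set `S̃` of simple reflections: the reflections in the walls of the base alcove. -/
def simpleReflections [Finite ι] : Set D.IwahoriWeyl :=
  {s | ∃ i k, D.IsWall i k ∧ D.IsReflection i k s}

/-- The group `Ω`, as a set: the elements of `W̃` that map the base alcove onto itself. -/
def Ω [Finite ι] : Set D.IwahoriWeyl := {τ | D.apartmentAct τ '' D.alcove = D.alcove}

/-- The length function of `W̃ = W_a ⋊ Ω`: the length of `w τ`, with `w ∈ W_a` and `τ ∈ Ω`, is the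
least number of factors in an expression of `w` as a product of simple reflections. -/
def length [Finite ι] (x : D.IwahoriWeyl) : ℕ :=
  sInf {n | ∃ l : List D.IwahoriWeyl, (∀ s ∈ l, s ∈ D.simpleReflections) ∧ l.length = n ∧
    ∃ τ ∈ D.Ω, l.prod * τ = x}

/-- The Bruhat order on `W̃`: generated by the relations `x < r x` for affine reflections `r`
with `ℓ(x) < ℓ(r x)`. As reflections lie in `W_a`, this is the Bruhat order of the Coxeter group
`W_a` on each coset `W_a τ`, and elements of different cosets are not comparable. -/
def BruhatLE [Finite ι] : D.IwahoriWeyl → D.IwahoriWeyl → Prop :=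
  Relation.ReflTransGen fun x y =>
    (∃ r i k, D.IsReflection i k r ∧ y = r * x) ∧ D.length x < D.length y

/-! ### Parabolic subgroups and admissible sets -/

/-- The parabolic subgroup `W_J`, generated by `J ⊆ S̃`. -/
def parabolic (J : Set D.IwahoriWeyl) : Subgroup D.IwahoriWeyl := Subgroup.closure J

/-- The set `ᴶW̃` of elements of minimal length in their cosets in `W_J \ W̃`. -/
def minReps [Finite ι] (J : Set D.IwahoriWeyl) : Set D.IwahoriWeyl :=
  {w | ∀ u ∈ D.parabolic J, D.length w ≤ D.length (u * w)}

/-- Dominance of a cocharacter with respect to the base. -/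
def IsDominant (μ : Y) : Prop := ∀ i ∈ D.base.support, 0 ≤ D.P.toLinearMap (D.P.root i) μ

/-- The `μ`-admissible set `Adm(μ)`: the elements below some `t^{x(μ̲)}` with `x ∈ W₀`, where `μ̲` is
the image of `μ` in `X_*(T)_Γ`. -/
def Adm [Finite ι] (μ : Y) : Set D.IwahoriWeyl :=
  {w | ∃ x : D.W₀, D.BruhatLE w (D.t (D.weylAct x (D.toCoinv μ)))}

/-- The admissible set `Admᴶ(μ) = W_J Adm(μ) W_J`. -/
def AdmJ [Finite ι] (J : Set D.IwahoriWeyl) (μ : Y) : Set D.IwahoriWeyl :=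
  (D.parabolic J : Set D.IwahoriWeyl) * D.Adm μ * (D.parabolic J : Set D.IwahoriWeyl)

end QuasiSplitRootDatum

end

/-!
The inclusion of the right-hand side in the left-hand side is trivial. For the other one, let `w`
be minimal in its coset `W_J w` and `w = u y v` with `u, v ∈ W_J` and `y ≤ t^λ`, where `λ` is a
conjugate of the image of `μ` under the relative Weyl group.

*A `J`-dominant translation.* The group `W_J` is finite, so the orbit of `λ` under the linear
parts of the elements of `W_J` contains some `λ'` which is nonnegative on the gradients of all
affine roots that are positive on the base alcove and bound it along a wall in `J`: one maximizes
over the orbit the inner product with the vector from the barycenter of the `W_J`-orbit of a point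
of the base alcove to that point (`exists_jDominant_t`). Then `t' = t^{λ'}` is conjugate to `t^λ`
under `W_J`, and for `s ∈ J` either `t' s = s t'` or `t' s < t'` (`jDominant_t`): such an affine
root takes values in `(0, 1)` on the base alcove, so a translation with a positive integral
displacement makes it negative there.

*Right multiplication.* If `x ≤ u t'` with `u ∈ W_J` and `s ∈ J`, then `x s ≤ u t'` or
`x s ≤ u t' s`, and in the second case `u t' s` is equal to `u s t'` or, by `t' s < t'`, it lies below some
element of `W_J t'`. Hence the elements below `W_J t'` are stable under multiplication by `W_J` on
the right, as they are on the left. They contain `t^λ`, hence `y`, hence `w`. Finally, `w` is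
minimal in `W_J w`, so the lifting property of the Bruhat order removes the factor in `W_J` and
gives `w ≤ t'` (`RootAction.le_of_mem_double_coset`).

The facts on the length and the Bruhat order that this uses are derived from the geometry. The
structure `RootAction` collects the properties of the Iwahori-Weyl group acting on the
half-apartments bounded by the affine root hyperplanes from which it follows that the length is
the number of hyperplanes separating the base alcove from its image, and that the lifting property
holds. They are proved for `QuasiSplitRootDatum` in `rootAction`, and the two notions of length
and of Bruhat order are compared in `length_eq_len` and `bruhatLE_iff`. This needs the following
facts.

* Each relative root has a reflection in the relative Weyl group (`exists_reflection`). A Galois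
  orbit of roots either consists of pairwise orthogonal roots, and one takes the product of their
  reflections, or of pairs spanning systems of type `A₂`, and one takes the product of the
  reflections in the sums of the pairs.
* The affine reflection in a hyperplane is unique (`IsReflection.unique`), in spite of the torsion
  of the coinvariants: the relative Weyl group acts faithfully on the coinvariants
  (`weylAct_injective`), and the image of the coroot lattice is torsion free
  (`eq_zero_of_forall_relRoot_eq_zero`).
* A point separated from the base alcove is separated from it by a wall (`exists_isWall`).
-/

noncomputable section

/-! ### Reflections permuting roots, and the length -/

/-- A group `G` permuting a set `R` of roots, to each of which a reflection in `G` is attached: the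
part of the combinatorics of an affine Weyl group, extended by elements preserving the base alcove,
that the length function and the Bruhat order depend on. A root stands for a half-apartment, and it
is positive if the half-apartment contains the base alcove. Thus `Pos (act x⁻¹ a)` means that `a`
contains the image of the base alcove under `x`. -/
structure RootAction (G R : Type*) [Group G] where
  /-- The action of the group on the roots. -/
  act : G →* Equiv.Perm R
  /-- The negative of a root. -/
  neg : R → R
  /-- Positivity of a root. -/
  Pos : R → Prop
  /-- The reflection attached to a root. -/
  refl : R → G
  /-- The simple roots, which correspond to the walls of the base alcove. -/
  simple : Set R
  act_neg : ∀ g a, act g (neg a) = neg (act g a)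
  pos_neg : ∀ a, Pos (neg a) ↔ ¬ Pos a
  refl_neg : ∀ a, refl (neg a) = refl a
  refl_mul_self : ∀ a, refl a * refl a = 1
  refl_act_self : ∀ a, act (refl a) a = neg a
  refl_act : ∀ g a, refl (act g a) = g * refl a * g⁻¹
  finite_inversions : ∀ x, {a | Pos a ∧ ¬ Pos (act x⁻¹ a)}.Finite
  /-- If the reflection in `a` makes the positive root `b` negative, then the reflected root is `b`
  minus a positive multiple of `a`, so that it is negative wherever `b` is and `a` is not. -/
  not_pos_act_refl : ∀ a b x, Pos a → Pos b → ¬ Pos (act (refl a) b) → Pos (act x⁻¹ a) →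
    ¬ Pos (act x⁻¹ b) → ¬ Pos (act x⁻¹ (act (refl a) b))
  simple_pos : ∀ a ∈ simple, Pos a
  /-- A simple reflection makes no other positive root negative. -/
  eq_of_simple : ∀ a ∈ simple, ∀ b, Pos b → ¬ Pos (act (refl a) b) → b = a
  /-- An alcove separated from the base alcove is separated from it by one of its walls. -/
  exists_simple : ∀ a x, Pos a → ¬ Pos (act x⁻¹ a) → ∃ s ∈ simple, ¬ Pos (act x⁻¹ s)

namespace RootAction

variable {G R : Type*} [Group G] (A : RootAction G R)

lemma act_mul_apply (g h : G) (a : R) : A.act (g * h) a = A.act g (A.act h a) := by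
  rw [map_mul, Equiv.Perm.mul_apply]

lemma act_one_apply (a : R) : A.act 1 a = a := by rw [map_one, Equiv.Perm.one_apply]

lemma act_inv_act (g : G) (a : R) : A.act g⁻¹ (A.act g a) = a := by
  rw [← act_mul_apply, inv_mul_cancel, act_one_apply]

lemma refl_inv (a : R) : (A.refl a)⁻¹ = A.refl a :=
  inv_eq_of_mul_eq_one_left (A.refl_mul_self a)

lemma act_refl_act_refl (a b : R) : A.act (A.refl a) (A.act (A.refl a) b) = b := by
  rw [← act_mul_apply, refl_mul_self, act_one_apply]

lemma refl_mul_cancel (a : R) (x : G) : A.refl a * (A.refl a * x) = x := by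
  rw [← mul_assoc, refl_mul_self, one_mul]

/-- The positive roots made negative by `x⁻¹`: the walls separating the base alcove from its image
under `x`. -/
def inversions (x : G) : Set R := {a | A.Pos a ∧ ¬ A.Pos (A.act x⁻¹ a)}

/-- The number of walls separating the base alcove from its image under `x`. -/
def len (x : G) : ℕ := (A.inversions x).ncard

lemma act_refl_mul_inv (a : R) (x : G) (b : R) :
    A.act (A.refl a * x)⁻¹ b = A.act x⁻¹ (A.act (A.refl a) b) := by
  rw [mul_inv_rev, act_mul_apply, refl_inv]

lemma act_inv_refl_self (a : R) (x : G) :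
    A.act (A.refl a * x)⁻¹ a = A.neg (A.act x⁻¹ a) := by
  rw [act_refl_mul_inv, refl_act_self, act_neg]

open Classical in
/-- Multiplication by a reflection moving the alcove across a wall which did not separate it from
the base alcove increases the number of separating walls: `b ↦ r b` or `b` is an injection between
the sets of separating walls which misses the wall of `r`. -/
lemma len_lt_len_refl_mul {a : R} {x : G} (ha : A.Pos a) (hx : A.Pos (A.act x⁻¹ a)) :
    A.len x < A.len (A.refl a * x) := by
  let f : R → R := fun b => if A.Pos (A.act (A.refl a) b) then A.act (A.refl a) b else b
  have hmaps : ∀ b ∈ A.inversions x, f b ∈ A.inversions (A.refl a * x) \ {a} := by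
    rintro b ⟨hb, hbx⟩
    by_cases h : A.Pos (A.act (A.refl a) b)
    · have hf : f b = A.act (A.refl a) b := if_pos h
      rw [hf]
      refine ⟨⟨h, ?_⟩, ?_⟩
      · rwa [act_refl_mul_inv, act_refl_act_refl]
      · intro hba
        have hba' : A.act (A.refl a) b = a := hba
        have : b = A.neg a := by
          rw [← A.act_refl_act_refl a b, hba', refl_act_self]
        rw [this, A.pos_neg] at hb
        exact hb ha
    · have hf : f b = b := if_neg h
      rw [hf]
      refine ⟨⟨hb, ?_⟩, ?_⟩
      · rw [act_refl_mul_inv]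
        exact A.not_pos_act_refl a b x ha hb h hx hbx
      · rintro rfl
        exact hbx hx
  have hinj : Set.InjOn f (A.inversions x) := by
    rintro b ⟨hb, -⟩ c ⟨hc, -⟩ hbc
    by_cases h : A.Pos (A.act (A.refl a) b) <;> by_cases h' : A.Pos (A.act (A.refl a) c)
    · simp only [f, if_pos h, if_pos h'] at hbc
      exact (A.act (A.refl a)).injective hbc
    · simp only [f, if_pos h, if_neg h'] at hbc
      rw [← hbc, act_refl_act_refl] at h'
      exact absurd hb h'
    · simp only [f, if_neg h, if_pos h'] at hbc
      rw [hbc, act_refl_act_refl] at h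
      exact absurd hc h
    · simpa only [f, if_neg h, if_neg h'] using hbc
  have hfin := A.finite_inversions (A.refl a * x)
  have hmem : a ∈ A.inversions (A.refl a * x) := by
    refine ⟨ha, ?_⟩
    rw [act_inv_refl_self, A.pos_neg, not_not]
    exact hx
  calc A.len x ≤ (A.inversions (A.refl a * x) \ {a}).ncard :=
        Set.ncard_le_ncard_of_injOn f hmaps hinj (hfin.subset Set.sdiff_subset)
    _ < A.len (A.refl a * x) := Set.ncard_sdiff_singleton_lt_of_mem hmem hfin

/-- A reflection increases the length if and only if its wall does not separate. -/
lemma len_lt_len_refl_mul_iff {a : R} (x : G) (ha : A.Pos a) :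
    A.len x < A.len (A.refl a * x) ↔ A.Pos (A.act x⁻¹ a) := by
  refine ⟨fun h => ?_, A.len_lt_len_refl_mul ha⟩
  by_contra hx
  have := A.len_lt_len_refl_mul (x := A.refl a * x) ha
    (by rw [act_inv_refl_self, A.pos_neg]; exact hx)
  rw [refl_mul_cancel] at this
  exact lt_asymm h this

lemma len_refl_mul_lt_iff {a : R} (x : G) (ha : A.Pos a) :
    A.len (A.refl a * x) < A.len x ↔ ¬ A.Pos (A.act x⁻¹ a) := by
  have := A.len_lt_len_refl_mul_iff (A.refl a * x) ha
  rwa [refl_mul_cancel, act_inv_refl_self, A.pos_neg] at this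

lemma len_refl_mul_le {a : R} (ha : a ∈ A.simple) (x : G) :
    A.len (A.refl a * x) ≤ A.len x + 1 := by
  have hsub : A.inversions (A.refl a * x) ⊆ insert a (A.act (A.refl a) '' A.inversions x) := by
    rintro b ⟨hb, hbx⟩
    by_cases h : A.Pos (A.act (A.refl a) b)
    · refine Or.inr ⟨A.act (A.refl a) b, ⟨h, ?_⟩, A.act_refl_act_refl a b⟩
      rwa [← act_refl_mul_inv]
    · exact Or.inl (A.eq_of_simple a ha b hb h)
  have hfin : (A.inversions x).Finite := A.finite_inversions x
  calc A.len (A.refl a * x) ≤ (insert a (A.act (A.refl a) '' A.inversions x)).ncard :=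
        Set.ncard_le_ncard hsub ((hfin.image _).insert a)
    _ ≤ (A.act (A.refl a) '' A.inversions x).ncard + 1 := Set.ncard_insert_le _ _
    _ ≤ A.len x + 1 := Nat.add_le_add_right (Set.ncard_image_le hfin) 1

/-- A word has at least as many letters as its product has separating walls. -/
lemma len_list_prod_mul_le (l : List G) (hl : ∀ s ∈ l, s ∈ A.refl '' A.simple) {τ : G}
    (hτ : A.len τ = 0) : A.len (l.prod * τ) ≤ l.length := by
  induction l with
  | nil => simp [hτ]
  | cons s l ih =>
    obtain ⟨a, ha, rfl⟩ := hl s (by simp)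
    rw [List.prod_cons, mul_assoc, List.length_cons]
    exact (A.len_refl_mul_le ha _).trans
      (Nat.add_le_add_right (ih fun s hs => hl s (by simp [hs])) 1)

/-- Crossing walls of the base alcove one after another brings an alcove back to the base alcove, in
as many steps as there are separating walls. -/
lemma exists_list_prod_mul_eq (x : G) :
    ∃ l : List G, (∀ s ∈ l, s ∈ A.refl '' A.simple) ∧ l.length = A.len x ∧
      ∃ τ, A.len τ = 0 ∧ l.prod * τ = x := by
  induction hn : A.len x using Nat.strong_induction_on generalizing x with
  | _ n ih =>
    rcases Nat.eq_zero_or_pos n with rfl | hpos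
    · exact ⟨[], by simp, rfl, x, hn, by simp⟩
    · obtain ⟨b, hb, hbx⟩ : (A.inversions x).Nonempty :=
        Set.nonempty_of_ncard_ne_zero (by change A.len x ≠ 0; omega)
      obtain ⟨a, ha, hax⟩ := A.exists_simple b x hb hbx
      have h1 := (A.len_refl_mul_lt_iff x (A.simple_pos a ha)).2 hax
      have h2 := A.len_refl_mul_le ha (A.refl a * x)
      rw [refl_mul_cancel] at h2
      obtain ⟨l, hl, hlen, τ, hτ, hx⟩ := ih (A.len (A.refl a * x)) (by omega) (A.refl a * x) rfl
      refine ⟨A.refl a :: l, ?_, by rw [List.length_cons]; omega, τ, hτ, ?_⟩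
      · intro s hs
        rcases List.mem_cons.1 hs with rfl | hs
        · exact ⟨a, ha, rfl⟩
        · exact hl s hs
      · rw [List.prod_cons, mul_assoc, hx, refl_mul_cancel]

/-- The word length, up to elements fixing the base alcove, is the number of separating walls. -/
lemma sInf_length_eq_len (x : G) :
    sInf {n | ∃ l : List G, (∀ s ∈ l, s ∈ A.refl '' A.simple) ∧ l.length = n ∧
      ∃ τ, A.len τ = 0 ∧ l.prod * τ = x} = A.len x := by
  refine le_antisymm (Nat.sInf_le ?_) (le_csInf ⟨A.len x, A.exists_list_prod_mul_eq x⟩ ?_)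
  · exact A.exists_list_prod_mul_eq x
  · rintro n ⟨l, hl, rfl, τ, hτ, rfl⟩
    exact A.len_list_prod_mul_le l hl hτ

/-! ### The Bruhat order -/

/-- The generating relation of the Bruhat order: left multiplication by a reflection in a wall which
does not separate the alcove of `x` from the base alcove. -/
def Step (x y : G) : Prop := ∃ a, A.Pos a ∧ A.Pos (A.act x⁻¹ a) ∧ y = A.refl a * x

/-- The Bruhat order. -/
def Le : G → G → Prop := Relation.ReflTransGen A.Step

lemma step_iff (x y : G) : A.Step x y ↔ (∃ a, y = A.refl a * x) ∧ A.len x < A.len y := by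
  constructor
  · rintro ⟨a, ha, hx, rfl⟩
    exact ⟨⟨a, rfl⟩, A.len_lt_len_refl_mul ha hx⟩
  · rintro ⟨⟨a, rfl⟩, h⟩
    by_cases ha : A.Pos a
    · exact ⟨a, ha, (A.len_lt_len_refl_mul_iff x ha).1 h, rfl⟩
    · rw [← A.pos_neg] at ha
      rw [← A.refl_neg] at h ⊢
      exact ⟨A.neg a, ha, (A.len_lt_len_refl_mul_iff x ha).1 h, rfl⟩

lemma step_refl_mul_or {a : R} (ha : A.Pos a) (x : G) :
    A.Step x (A.refl a * x) ∨ A.Step (A.refl a * x) x := by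
  by_cases h : A.Pos (A.act x⁻¹ a)
  · exact Or.inl ⟨a, ha, h, rfl⟩
  · refine Or.inr ⟨a, ha, ?_, (A.refl_mul_cancel a x).symm⟩
    rwa [act_inv_refl_self, A.pos_neg]

/-- Left multiplication by a simple reflection preserves a step, unless it inverts it. -/
lemma Step.simple_mul {x y : G} (h : A.Step x y) {s : R} (hs : s ∈ A.simple) :
    A.refl s * x = y ∨ A.Step (A.refl s * x) (A.refl s * y) := by
  obtain ⟨a, ha, hx, rfl⟩ := h
  by_cases hsa : A.Pos (A.act (A.refl s) a)
  · refine Or.inr ⟨_, hsa, ?_, ?_⟩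
    · rwa [act_refl_mul_inv, act_refl_act_refl]
    · rw [A.refl_act, refl_inv, mul_assoc, refl_mul_cancel, mul_assoc]
  · left
    rw [A.eq_of_simple s hs a ha hsa]

/-- Right multiplication by a simple reflection preserves a step, unless it inverts it. -/
lemma Step.mul_simple {x y : G} (h : A.Step x y) {s : R} (hs : s ∈ A.simple) :
    x * A.refl s = y ∨ A.Step (x * A.refl s) (y * A.refl s) := by
  obtain ⟨a, ha, hx, rfl⟩ := h
  by_cases hsa : A.Pos (A.act (A.refl s) (A.act x⁻¹ a))
  · refine Or.inr ⟨a, ha, ?_, by rw [mul_assoc]⟩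
    rwa [mul_inv_rev, act_mul_apply, refl_inv]
  · left
    rw [← A.eq_of_simple s hs _ hx hsa, A.refl_act]
    group

lemma Le.simple_mul {x y : G} (h : A.Le x y) {s : R} (hs : s ∈ A.simple) :
    A.Le (A.refl s * x) y ∨ A.Le (A.refl s * x) (A.refl s * y) := by
  induction h using Relation.ReflTransGen.head_induction_on with
  | refl => exact Or.inr Relation.ReflTransGen.refl
  | head hstep hle ih =>
    rcases Step.simple_mul A hstep hs with h | h
    · exact Or.inl (h ▸ hle)
    · exact ih.imp (Relation.ReflTransGen.head h) (Relation.ReflTransGen.head h)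

lemma Le.mul_simple {x y : G} (h : A.Le x y) {s : R} (hs : s ∈ A.simple) :
    A.Le (x * A.refl s) y ∨ A.Le (x * A.refl s) (y * A.refl s) := by
  induction h using Relation.ReflTransGen.head_induction_on with
  | refl => exact Or.inr Relation.ReflTransGen.refl
  | head hstep hle ih =>
    rcases Step.mul_simple A hstep hs with h | h
    · exact Or.inl (h ▸ hle)
    · exact ih.imp (Relation.ReflTransGen.head h) (Relation.ReflTransGen.head h)

/-- The lifting property of the Bruhat order. -/
lemma Le.lifting {w y : G} (h : A.Le w y) {s : R} (hs : s ∈ A.simple)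
    (hw : A.Step w (A.refl s * w)) (hy : A.Step (A.refl s * y) y) : A.Le w (A.refl s * y) := by
  induction h with
  | refl =>
    exact absurd ((A.step_iff _ _).1 hw).2 (lt_asymm ((A.step_iff _ _).1 hy).2)
  | @tail y' y hle hstep ih =>
    rcases Step.simple_mul A hstep hs with h | h
    · rw [← h, refl_mul_cancel]
      exact hle
    · rcases A.step_refl_mul_or (A.simple_pos s hs) y' with h' | h'
      · exact (hle.tail h').tail h
      · exact (ih h').tail h

/-- An element which a simple reflection `s` makes longer lies below `x` if it lies below `s x`. -/
lemma Le.of_le_simple_mul {w x : G} {s : R} (h : A.Le w (A.refl s * x)) (hs : s ∈ A.simple)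
    (hw : A.Step w (A.refl s * w)) : A.Le w x := by
  rcases A.step_refl_mul_or (A.simple_pos s hs) x with h' | h'
  · have := Le.lifting A h hs hw (by rwa [refl_mul_cancel])
    rwa [refl_mul_cancel] at this
  · exact h.tail h'

/-! ### Parabolic double cosets -/

variable {J : Set G} (hJ : J ⊆ A.refl '' A.simple)

include hJ in
/-- Induction along a word of an element of a parabolic subgroup. -/
lemma closure_induction_left {p : G → Prop} (one : p 1)
    (mul : ∀ s ∈ A.simple, A.refl s ∈ J → ∀ u ∈ Subgroup.closure J, p u → p (A.refl s * u))
    {u : G} (hu : u ∈ Subgroup.closure J) : p u := by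
  induction hu using Subgroup.closure_induction_left with
  | one => exact one
  | mul_left s hs u hu ih =>
    obtain ⟨a, ha, rfl⟩ := hJ hs
    exact mul a ha hs u hu ih
  | inv_mul_cancel s hs u hu ih =>
    obtain ⟨a, ha, rfl⟩ := hJ hs
    rw [refl_inv]
    exact mul a ha hs u hu ih

include hJ in
lemma Le.exists_left_mul {x y u : G} (h : A.Le x y) (hu : u ∈ Subgroup.closure J) :
    ∃ v ∈ Subgroup.closure J, A.Le (u * x) (v * y) := by
  refine A.closure_induction_left hJ (p := fun u => ∃ v ∈ Subgroup.closure J, A.Le (u * x) (v * y))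
    ⟨1, one_mem _, by simpa using h⟩ ?_ hu
  rintro s hs hsJ u - ⟨v, hv, hle⟩
  rcases Le.simple_mul A hle hs with h | h
  · exact ⟨v, hv, by rwa [mul_assoc]⟩
  · exact ⟨A.refl s * v, mul_mem (Subgroup.subset_closure hsJ) hv, by rwa [mul_assoc, mul_assoc]⟩

/-- An element is `J`-dominant if each simple reflection in `J` either commutes with it or makes it
shorter on multiplication from the right. -/
def JDominant (J : Set G) (t : G) : Prop :=
  ∀ s ∈ A.simple, A.refl s ∈ J → t * A.refl s = A.refl s * t ∨ A.Step (t * A.refl s) t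

variable {A} in
include hJ in
/-- Below a `J`-dominant `t`, right multiplication by `W_J` does not leave the elements below
`W_J t`. -/
lemma JDominant.exists_le_mul {t : G} (ht : A.JDominant J t) {x : G}
    (hx : ∃ u ∈ Subgroup.closure J, A.Le x (u * t)) {v : G} (hv : v ∈ Subgroup.closure J) :
    ∃ u ∈ Subgroup.closure J, A.Le (x * v) (u * t) := by
  refine A.closure_induction_left hJ (p := fun v => ∀ x,
    (∃ u ∈ Subgroup.closure J, A.Le x (u * t)) → ∃ u ∈ Subgroup.closure J, A.Le (x * v) (u * t))
    (fun x hx => by simpa using hx) ?_ hv x hx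
  intro s hs hsJ v _ ih x hx
  rw [← mul_assoc]
  refine ih _ ?_
  obtain ⟨u, hu, hle⟩ := hx
  rcases Le.mul_simple A hle hs with h | h
  · exact ⟨u, hu, h⟩
  · rcases ht s hs hsJ with hc | hlt
    · refine ⟨u * A.refl s, mul_mem hu (Subgroup.subset_closure hsJ), ?_⟩
      rwa [mul_assoc, ← hc, ← mul_assoc]
    · obtain ⟨u', hu', h'⟩ := Le.exists_left_mul A hJ (Relation.ReflTransGen.single hlt) hu
      refine ⟨u', hu', h.trans ?_⟩
      rwa [mul_assoc]

include hJ in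
/-- An element which is minimal in its coset `W_J w` and lies below `W_J t` lies below `t`. -/
lemma le_of_le_closure_mul {w t u : G} (hu : u ∈ Subgroup.closure J)
    (hw : ∀ s ∈ A.simple, A.refl s ∈ J → A.Step w (A.refl s * w)) (h : A.Le w (u * t)) :
    A.Le w t := by
  revert h
  refine A.closure_induction_left hJ (p := fun u => A.Le w (u * t) → A.Le w t)
    (fun h => by simpa using h) ?_ hu
  intro s hs hsJ u _ ih h
  rw [mul_assoc] at h
  exact ih (Le.of_le_simple_mul A h hs (hw s hs hsJ))

include hJ in
/-- If `t'` is conjugate under `W_J` to a `J`-dominant element `t`, then the elements of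
`W_J {y ≤ t'} W_J` which are minimal in their coset modulo `W_J` on the left lie below `t`. -/
theorem le_of_mem_double_coset {t c w y u v : G} (ht : A.JDominant J t)
    (hc : c ∈ Subgroup.closure J) (hu : u ∈ Subgroup.closure J) (hv : v ∈ Subgroup.closure J)
    (hw : ∀ s ∈ A.simple, A.refl s ∈ J → A.Step w (A.refl s * w))
    (hy : A.Le y (c⁻¹ * t * c)) (h : u * y * v = w) : A.Le w t := by
  -- `W_J t` contains `c⁻¹ t`, so right multiplication by `c` gives an element below `W_J t`
  have h1 : ∃ u' ∈ Subgroup.closure J, A.Le (c⁻¹ * t * c) (u' * t) := by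
    refine ht.exists_le_mul hJ ?_ hc
    exact ⟨c⁻¹, inv_mem hc, Relation.ReflTransGen.refl⟩
  obtain ⟨u', hu', h1⟩ := h1
  obtain ⟨u'', hu'', h2⟩ := Le.exists_left_mul A hJ (Relation.ReflTransGen.trans hy h1) hu
  obtain ⟨z, hz, h3⟩ := ht.exists_le_mul hJ (x := u * y)
    ⟨u'' * u', mul_mem hu'' hu', by rwa [mul_assoc]⟩ hv
  rw [h] at h3
  exact A.le_of_le_closure_mul hJ hz hw h3

end RootAction

section RootPairing

/-! ### Automorphisms of root data and positive roots -/

variable {ι X Y : Type*} [AddCommGroup X] [AddCommGroup Y] {P : RootPairing ι ℤ X Y}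

lemma coweightRep_coroot (g : P.Aut) (i : ι) :
    coweightRep P g (P.coroot i) = P.coroot (RootPairing.Equiv.indexHom P g i) := by
  have h := RootPairing.Hom.coroot_coweightMap_apply P P i (g⁻¹).toHom
  exact h

lemma root'_coweightRep (g : P.Aut) (i : ι) (y : Y) :
    P.root' (RootPairing.Equiv.indexHom P g i) (coweightRep P g y) = P.root' i y := by
  have h1 := LinearMap.congr_fun (RootPairing.Hom.weight_coweight_transpose_apply P P
    (coweightRep P g y) g.toHom) (P.root i)
  have h2 := RootPairing.Hom.root_weightMap_apply P P i g.toHom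
  have h3 : g.toHom.coweightMap (coweightRep P g y) = y := by simp [coweightRep]
  change P.toLinearMap (g.toHom.weightMap (P.root i)) (coweightRep P g y)
    = P.toLinearMap (P.root i) (g.toHom.coweightMap (coweightRep P g y)) at h1
  rw [h2, h3] at h1
  exact h1

lemma pairing_indexHom (g : P.Aut) (i j : ι) :
    P.pairing (RootPairing.Equiv.indexHom P g i) (RootPairing.Equiv.indexHom P g j)
      = P.pairing i j := by
  have := root'_coweightRep g i (P.coroot j)
  rwa [coweightRep_coroot] at this

lemma coweightRep_reflection (i : ι) (y : Y) :
    coweightRep P (RootPairing.Equiv.reflection P i) y = y - P.root' i y • P.coroot i := by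
  have : coweightRep P (RootPairing.Equiv.reflection P i) y = P.coreflection i y := by
    change RootPairing.Equiv.coweightEquiv P P (RootPairing.Equiv.reflection P i)⁻¹ y = _
    rw [RootPairing.Equiv.reflection_inv]
    rfl
  rw [this, RootPairing.coreflection_apply]

lemma coweightRep_injective : Function.Injective (coweightRep P) := by
  intro g h hgh
  have : RootPairing.Equiv.coweightHom P g⁻¹ = RootPairing.Equiv.coweightHom P h⁻¹ := by
    apply MulOpposite.unop_injective
    ext y
    exact LinearMap.congr_fun hgh y
  exact inv_injective (RootPairing.Equiv.coweightHom_injective P this)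

lemma reflection_indexHom (g : P.Aut) (i : ι) :
    RootPairing.Equiv.reflection P (RootPairing.Equiv.indexHom P g i) =
      g * RootPairing.Equiv.reflection P i * g⁻¹ := by
  rw [eq_mul_inv_iff_mul_eq]
  apply coweightRep_injective
  ext y
  simp only [map_mul, Module.End.mul_apply, coweightRep_reflection, map_sub, map_zsmul,
    coweightRep_coroot, root'_coweightRep]

lemma indexHom_reflection (i j : ι) :
    RootPairing.Equiv.indexHom P (RootPairing.Equiv.reflection P i) j = P.reflectionPerm i j := rfl

variable (b : P.Base)

lemma RootPairing.Base.isPos_iff_mem_closure (i : ι) :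
    b.IsPos i ↔ P.root i ∈ AddSubmonoid.closure (P.root '' b.support) := by
  have key : ∀ i, P.root i ∈ AddSubmonoid.closure (P.root '' b.support) → b.IsPos i := by
    intro i hi
    obtain ⟨f, hf⟩ : ∃ f : ι → ℕ, P.root i = ∑ j ∈ b.support, f j • P.root j := by
      classical
      refine AddSubmonoid.closure_induction (motive := fun x _ =>
        ∃ f : ι → ℕ, x = ∑ j ∈ b.support, f j • P.root j) ?_ ⟨0, by simp⟩ ?_ hi
      · rintro _ ⟨j, hj, rfl⟩
        refine ⟨Pi.single j 1, ?_⟩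
        rw [Finset.sum_eq_single_of_mem j hj (by simp +contextual)]
        simp
      · rintro _ _ _ _ ⟨f, rfl⟩ ⟨g, rfl⟩
        exact ⟨f + g, by simp [add_smul, Finset.sum_add_distrib]⟩
    rw [RootPairing.Base.isPos_iff',
      RootPairing.Base.height_eq_sum (f := fun j => (f j : ℤ)) (by simpa using hf)]
    positivity
  refine ⟨fun h => ?_, key i⟩
  rcases b.root_mem_or_neg_mem i with h' | h'
  · exact h'
  · let _ := P.indexNeg
    have := key (-i) (by
      rwa [P.indexNeg_neg, RootPairing.root_reflectionPerm, RootPairing.reflection_apply_self])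
    rw [RootPairing.Base.IsPos.neg_iff_not] at this
    exact absurd h this

variable [Finite ι] [P.IsReduced]

/-- The exchange property in the finite Weyl group. -/
lemma RootPairing.Base.exists_exchange (l : List ι) (hl : ∀ k ∈ l, k ∈ b.support) {j : ι}
    (hj : j ∈ b.support)
    (h : ¬ b.IsPos (Equiv.indexHom P (l.map (Equiv.reflection P)).prod j)) :
    ∃ m : List ι, (∀ k ∈ m, k ∈ b.support) ∧ m.length + 1 = l.length ∧
      (l.map (Equiv.reflection P)).prod * Equiv.reflection P j =
        (m.map (Equiv.reflection P)).prod := by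
  induction l with
  | nil => exact absurd (b.isPos_of_mem_support hj) (by simpa using h)
  | cons k l ih =>
    set M := (l.map (Equiv.reflection P)).prod with hM
    simp only [List.map_cons, List.prod_cons] at h ⊢
    by_cases hMj : b.IsPos (Equiv.indexHom P M j)
    · have hk : Equiv.indexHom P M j = k := by
        by_contra hne
        apply h
        rw [map_mul, Equiv.Perm.mul_apply, indexHom_reflection]
        exact hMj.reflectionPerm (hl k (by simp)) hne
      refine ⟨l, fun i hi => hl i (by simp [hi]), by simp, ?_⟩
      have h1 : Equiv.reflection P k = M * Equiv.reflection P j * M⁻¹ := by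
        rw [← hk, reflection_indexHom]
      have h2 : Equiv.reflection P j * Equiv.reflection P j = 1 := by
        nth_rw 1 [← Equiv.reflection_inv P j]
        exact inv_mul_cancel _
      rw [h1, inv_mul_cancel_right, mul_assoc, h2, mul_one]
    · obtain ⟨m, hm, hlen, hprod⟩ := ih (fun i hi => hl i (by simp [hi])) hMj
      refine ⟨k :: m, ?_, by simp [hlen], ?_⟩
      · intro i hi
        rcases List.mem_cons.1 hi with rfl | hi
        · exact hl i (by simp)
        · exact hm i hi
      · rw [mul_assoc, hprod, List.map_cons, List.prod_cons]

lemma RootPairing.Base.exists_list_of_mem_weylGroup {w : P.Aut} (hw : w ∈ P.weylGroup) :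
    ∃ l : List ι, (∀ k ∈ l, k ∈ b.support) ∧ w = (l.map (Equiv.reflection P)).prod := by
  have hr : ∀ i, ∃ l : List ι, (∀ k ∈ l, k ∈ b.support) ∧
      Equiv.reflection P i = (l.map (Equiv.reflection P)).prod := by
    intro i
    refine b.induction_reflect i (p := fun i => ∃ l : List ι, (∀ k ∈ l, k ∈ b.support) ∧
      Equiv.reflection P i = (l.map (Equiv.reflection P)).prod) ?_
      (fun i hi => ⟨[i], by simpa using hi, by simp⟩) ?_
    · rintro i ⟨l, hl, h⟩
      refine ⟨l, hl, ?_⟩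
      rw [← indexHom_reflection, reflection_indexHom, mul_inv_cancel_right, h]
    · rintro i j ⟨l, hl, h⟩ hj
      refine ⟨j :: l ++ [j], ?_, ?_⟩
      · simp only [List.cons_append, List.mem_cons, List.mem_append, List.not_mem_nil, or_false]
        rintro k (rfl | hk | rfl)
        exacts [hj, hl k hk, hj]
      · rw [← indexHom_reflection, reflection_indexHom, h, Equiv.reflection_inv]
        simp
  induction hw using weylGroup.induction with
  | mem i => exact hr i
  | one => exact ⟨[], by simp, by simp⟩
  | mul x y _ _ hx hy =>
    obtain ⟨l, hl, rfl⟩ := hx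
    obtain ⟨m, hm, rfl⟩ := hy
    refine ⟨l ++ m, ?_, by simp⟩
    intro k hk
    rcases List.mem_append.1 hk with hk | hk
    exacts [hl k hk, hm k hk]

/-- An element of the Weyl group preserving the positive roots is trivial. -/
lemma RootPairing.Base.eq_one_of_forall_isPos {w : P.Aut} (hw : w ∈ P.weylGroup)
    (h : ∀ i, b.IsPos i → b.IsPos (Equiv.indexHom P w i)) : w = 1 := by
  obtain ⟨l, hl, rfl⟩ := b.exists_list_of_mem_weylGroup hw
  clear hw
  induction hn : l.length using Nat.strong_induction_on generalizing l with
  | _ n ih =>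
    rcases List.eq_nil_or_concat l with rfl | ⟨m, j, rfl⟩
    · simp
    · have hj : j ∈ b.support := hl j (by simp)
      have hmul : ((m ++ [j]).map (Equiv.reflection P)).prod
          = (m.map (Equiv.reflection P)).prod * Equiv.reflection P j := by simp
      have hneg : ¬ b.IsPos (Equiv.indexHom P (m.map (Equiv.reflection P)).prod j) := by
        have h1 := h j (b.isPos_of_mem_support hj)
        let _ := P.indexNeg
        rw [← IsPos.neg_iff_not]
        rw [List.concat_eq_append, hmul, map_mul, Equiv.Perm.mul_apply, indexHom_reflection] at h1
        convert h1 using 1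
        apply P.root.injective
        have e : ∀ (g : P.Aut) k, P.root (Equiv.indexHom P g k) = g • P.root k := fun g k =>
          Equiv.root_indexEquiv_eq_smul P k g
        rw [indexNeg_neg, root_reflectionPerm, reflection_apply_self, e, e, root_reflectionPerm,
          reflection_apply_self, smul_neg]
      obtain ⟨m', hm', hlen, hprod⟩ := b.exists_exchange m (fun k hk => hl k (by simp [hk])) hj hneg
      rw [List.concat_eq_append] at *
      rw [hmul, hprod] at h ⊢
      simp only [List.length_append, List.length_singleton] at hn
      exact ih m'.length (by omega) m' hm' h rfl

open Classical in
/-- The sum of the positive coroots. -/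
def RootPairing.Base.sumPosCoroot : Y :=
  ∑ i ∈ (Set.toFinite {i | b.IsPos i}).toFinset, P.coroot i

/-- The sum of the positive coroots pairs to `2` with each simple root. -/
lemma RootPairing.Base.root'_sumPosCoroot {j : ι} (hj : j ∈ b.support) :
    P.root' j b.sumPosCoroot = 2 := by
  classical
  have hmem : j ∈ (Set.toFinite {i | b.IsPos i}).toFinset := by
    simpa using b.isPos_of_mem_support hj
  rw [sumPosCoroot, map_sum, ← Finset.add_sum_erase _ _ hmem, root'_coroot_eq_pairing, pairing_same,
    add_eq_left]
  have hpair : ∀ i, P.root' j (P.coroot (P.reflectionPerm j i)) = - P.root' j (P.coroot i) := by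
    intro i
    rw [root'_coroot_eq_pairing, root'_coroot_eq_pairing, pairing_reflectionPerm,
      pairing_reflectionPerm_self_left]
  have hne : ∀ i, i ≠ j → b.IsPos i → P.reflectionPerm j i ≠ j := by
    intro i hij hi h
    have h2 : i = P.reflectionPerm j j := by
      nth_rw 2 [← h]
      rw [reflectionPerm_self]
    let _ := P.indexNeg
    have h3 : b.IsPos (-j) := by
      change b.IsPos (P.reflectionPerm j j)
      rwa [← h2]
    rw [IsPos.neg_iff_not] at h3
    exact h3 (b.isPos_of_mem_support hj)
  have : ∀ S : ℤ, S = -S → S = 0 := fun S h => by omega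
  apply this
  -- the reflection in the simple root `j` permutes the other positive roots
  rw [← Finset.sum_neg_distrib]
  refine Finset.sum_bij' (fun i _ => P.reflectionPerm j i) (fun i _ => P.reflectionPerm j i)
    ?_ ?_ (by simp) (by simp) (fun i _ => by rw [hpair, neg_neg])
  all_goals
    intro i hi
    simp only [Finset.mem_erase, Set.Finite.mem_toFinset, Set.mem_ofPred_eq] at hi ⊢
    exact ⟨hne i hi.1 hi.2, hi.2.reflectionPerm hj hi.1⟩

lemma RootPairing.Base.root'_sumPosCoroot_pos {i : ι} (hi : b.IsPos i) :
    0 < P.root' i b.sumPosCoroot := by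
  refine hi.induction_on_add (p := fun i => 0 < P.root' i b.sumPosCoroot)
    (fun j hj => by rw [b.root'_sumPosCoroot hj]; norm_num) ?_
  intro i j k hk hi hj
  have : P.root' k b.sumPosCoroot = P.root' i b.sumPosCoroot + P.root' j b.sumPosCoroot := by
    simp only [RootPairing.root', hk, map_add, LinearMap.add_apply]
  rw [this, b.root'_sumPosCoroot hj]
  omega

lemma RootPairing.Base.isPos_iff_root'_sumPosCoroot (i : ι) :
    b.IsPos i ↔ 0 < P.root' i b.sumPosCoroot := by
  refine ⟨b.root'_sumPosCoroot_pos, fun h => ?_⟩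
  by_contra hi
  let _ := P.indexNeg
  rw [← IsPos.neg_iff_not] at hi
  have := b.root'_sumPosCoroot_pos hi
  simp only [RootPairing.root', indexNeg_neg, root_reflectionPerm, reflection_apply_self, map_neg,
    LinearMap.neg_apply] at this h
  omega

lemma RootPairing.Base.root'_sumPosCoroot_ne_zero (i : ι) : P.root' i b.sumPosCoroot ≠ 0 := by
  let _ := P.indexNeg
  rcases IsPos.or_neg b i with h | h
  · exact (b.root'_sumPosCoroot_pos h).ne'
  · have := b.root'_sumPosCoroot_pos h
    simp only [RootPairing.root', indexNeg_neg, root_reflectionPerm, reflection_apply_self, map_neg,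
      LinearMap.neg_apply] at this ⊢
    omega

end RootPairing

namespace QuasiSplitRootDatum

variable {ι X Y Γ : Type*} [AddCommGroup X] [AddCommGroup Y] [Group Γ]
  (D : QuasiSplitRootDatum ι X Y Γ)

/-! ### Galois orbits of roots -/

/-- The permutation of the roots by which a Galois element acts. -/
abbrev idx (γ : Γ) : Equiv.Perm ι := RootPairing.Equiv.indexHom D.P (D.act γ)

lemma idx_mul (γ δ : Γ) (i : ι) : D.idx (γ * δ) i = D.idx γ (D.idx δ i) := by
  rw [idx, map_mul, map_mul, Equiv.Perm.mul_apply]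

lemma idx_inv_idx (γ : Γ) (i : ι) : D.idx γ⁻¹ (D.idx γ i) = i := by
  rw [← idx_mul, inv_mul_cancel, idx, map_one, map_one, Equiv.Perm.one_apply]

lemma idx_idx_inv (γ : Γ) (i : ι) : D.idx γ (D.idx γ⁻¹ i) = i := by
  rw [← idx_mul, mul_inv_cancel, idx, map_one, map_one, Equiv.Perm.one_apply]

lemma galRep_eq (γ : Γ) : D.galRep γ = coweightRep D.P (D.act γ) := rfl

lemma galRep_coroot (γ : Γ) (i : ι) : D.galRep γ (D.P.coroot i) = D.P.coroot (D.idx γ i) :=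
  coweightRep_coroot _ _

lemma root'_galRep (γ : Γ) (i : ι) (y : Y) :
    D.P.root' (D.idx γ i) (D.galRep γ y) = D.P.root' i y :=
  root'_coweightRep _ _ _

lemma pairing_idx (γ : Γ) (i j : ι) :
    D.P.pairing (D.idx γ i) (D.idx γ j) = D.P.pairing i j :=
  pairing_indexHom _ _ _

lemma toCoinv_galRep (γ : Γ) (y : Y) : D.toCoinv (D.galRep γ y) = D.toCoinv y := by
  rw [← sub_eq_zero, ← map_sub]
  exact (QuotientAddGroup.eq_zero_iff _).2 (AddSubgroup.subset_closure ⟨γ, y, rfl⟩)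

lemma relCoroot_idx (γ : Γ) (i : ι) : D.relCoroot (D.idx γ i) = D.relCoroot i := by
  rw [relCoroot, ← galRep_coroot, toCoinv_galRep, relCoroot]

lemma toCoinv_surjective : Function.Surjective D.toCoinv := QuotientAddGroup.mk_surjective

variable [Finite ι]

/-- The Galois orbit of a root, as a finite set. -/
abbrev orb (i : ι) : Finset ι := (Set.toFinite (D.orbit i)).toFinset

lemma mem_orb {i j : ι} : j ∈ D.orb i ↔ ∃ γ, D.idx γ i = j := by
  simp [orb, orbit]

lemma self_mem_orb (i : ι) : i ∈ D.orb i :=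
  D.mem_orb.2 ⟨1, by rw [idx, map_one, map_one, Equiv.Perm.one_apply]⟩

lemma idx_mem_orb_iff (γ : Γ) (i j : ι) : D.idx γ j ∈ D.orb i ↔ j ∈ D.orb i := by
  rw [mem_orb, mem_orb]
  constructor
  · rintro ⟨δ, h⟩
    exact ⟨γ⁻¹ * δ, by rw [idx_mul, h, idx_inv_idx]⟩
  · rintro ⟨δ, rfl⟩
    exact ⟨γ * δ, D.idx_mul γ δ i⟩

lemma orb_idx (γ : Γ) (i : ι) : D.orb (D.idx γ i) = D.orb i := by
  ext j
  rw [mem_orb, mem_orb]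
  constructor
  · rintro ⟨δ, rfl⟩
    exact ⟨δ * γ, D.idx_mul δ γ i⟩
  · rintro ⟨δ, rfl⟩
    exact ⟨δ * γ⁻¹, by rw [idx_mul, idx_inv_idx]⟩

lemma sum_orb_idx {M : Type*} [AddCommMonoid M] (γ : Γ) (i : ι) (f : ι → M) :
    ∑ j ∈ D.orb i, f (D.idx γ j) = ∑ j ∈ D.orb i, f j :=
  Finset.sum_equiv (D.idx γ) (fun j => (D.idx_mem_orb_iff γ i j).symm) fun _ _ => rfl

lemma relCoroot_eq_of_mem_orb {i j : ι} (h : j ∈ D.orb i) : D.relCoroot j = D.relCoroot i := by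
  obtain ⟨γ, rfl⟩ := D.mem_orb.1 h
  exact D.relCoroot_idx γ i

lemma orbitSum_apply (i : ι) (y : Y) : D.orbitSum i y = ∑ j ∈ D.orb i, D.P.root' j y := by
  simp [orbitSum, LinearMap.sum_apply]

lemma relRoot_toCoinv (i : ι) (y : Y) :
    D.relRoot i (D.toCoinv y) = D.orbitFactor i * D.orbitSum i y := rfl

omit [Finite ι] in
lemma orbitFactor_pos (i : ι) : 0 < D.orbitFactor i := by
  rw [orbitFactor]
  split_ifs <;> norm_num

instance : D.P.IsReduced := D.isReduced

lemma isPos_idx (γ : Γ) {i : ι} (hi : D.base.IsPos i) : D.base.IsPos (D.idx γ i) := by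
  refine hi.induction_on_add (p := fun i => D.base.IsPos (D.idx γ i))
    (fun j hj => D.base.isPos_of_mem_support (D.act_base γ j hj)) ?_
  intro i j k hk hi hj
  refine hi.add (D.base.isPos_of_mem_support (D.act_base γ j hj)) ?_
  have e : ∀ k, D.P.root (D.idx γ k) = D.act γ • D.P.root k := fun k =>
    RootPairing.Equiv.root_indexEquiv_eq_smul D.P k (D.act γ)
  rw [e, e, e, hk, smul_add]

/-- The sum of the positive coroots is a regular vector fixed by the Galois group. -/
lemma galRep_sumPosCoroot (γ : Γ) :
    D.galRep γ D.base.sumPosCoroot = D.base.sumPosCoroot := by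
  rw [RootPairing.Base.sumPosCoroot, map_sum]
  refine Finset.sum_equiv (D.idx γ) ?_ (fun i _ => D.galRep_coroot γ i)
  intro i
  simp only [Set.Finite.mem_toFinset, Set.mem_ofPred_eq]
  refine ⟨D.isPos_idx γ, fun h => ?_⟩
  have := D.isPos_idx γ⁻¹ h
  rwa [idx_inv_idx] at this

omit [Finite ι] in
lemma root'_idx_of_galRep_eq {y : Y} (hy : ∀ γ, D.galRep γ y = y) (γ : Γ) (i : ι) :
    D.P.root' (D.idx γ i) y = D.P.root' i y := by
  nth_rw 1 [← hy γ]
  exact D.root'_galRep γ i y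

/-- On vectors fixed by the Galois group an orbit sum is a positive multiple of the root. -/
lemma orbitSum_of_galRep_eq {y : Y} (hy : ∀ γ, D.galRep γ y = y) (i : ι) :
    D.orbitSum i y = (D.orb i).card * D.P.root' i y := by
  rw [orbitSum_apply, ← nsmul_eq_mul, ← Finset.sum_const]
  refine Finset.sum_congr rfl fun j hj => ?_
  obtain ⟨γ, rfl⟩ := D.mem_orb.1 hj
  exact D.root'_idx_of_galRep_eq hy γ i

lemma card_orb_pos (i : ι) : (0 : ℤ) < (D.orb i).card := by
  exact_mod_cast Finset.card_pos.2 ⟨i, D.self_mem_orb i⟩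

/-- Two distinct roots in a Galois orbit do not make an acute angle: otherwise their difference
would be a root vanishing on a regular vector. -/
lemma pairing_nonpos_of_mem_orb {i j : ι} (h : j ∈ D.orb i) (hne : j ≠ i) :
    D.P.pairing j i ≤ 0 := by
  by_contra! hpos
  have hin : D.P.pairingIn ℤ j i = D.P.pairing j i := by simpa using D.P.algebraMap_pairingIn ℤ j i
  obtain ⟨k, hk⟩ := D.P.root_sub_root_mem_of_pairingIn_pos (by rwa [hin]) hne
  apply D.base.root'_sumPosCoroot_ne_zero k
  obtain ⟨γ, rfl⟩ := D.mem_orb.1 h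
  have := D.root'_idx_of_galRep_eq D.galRep_sumPosCoroot γ i
  simp only [RootPairing.root'] at this ⊢
  rw [hk, map_sub, LinearMap.sub_apply, this, sub_self]

lemma sum_pairing_idx (γ : Γ) (i : ι) :
    ∑ l ∈ D.orb i, D.P.pairing l (D.idx γ i) = ∑ l ∈ D.orb i, D.P.pairing l i := by
  rw [← D.sum_orb_idx γ]
  exact Finset.sum_congr rfl fun l _ => D.pairing_idx γ l i

/-- The sum of the roots of a Galois orbit makes an acute angle with each of them, as this sum is
not zero. -/
lemma sum_pairing_pos (i : ι) : 0 < ∑ j ∈ D.orb i, D.P.pairing j i := by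
  have := Fintype.ofFinite ι
  by_contra! hC
  set σ := ∑ j ∈ D.orb i, D.P.root j with hσ
  have h1 : ∀ j ∈ D.orb i, 2 * D.P.RootForm (D.P.root j) σ ≤ 0 := by
    intro j hj
    have h2 := congrArg (D.P.toLinearMap σ) (D.P.rootForm_self_smul_coroot j)
    rw [map_smul, map_nsmul, D.P.toLinearMap_apply_apply_Polarization] at h2
    have h3 : D.P.toLinearMap σ (D.P.coroot j) = ∑ l ∈ D.orb i, D.P.pairing l i := by
      obtain ⟨γ, rfl⟩ := D.mem_orb.1 hj
      rw [← D.sum_pairing_idx γ, hσ, map_sum, LinearMap.sum_apply]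
      rfl
    rw [h3, smul_eq_mul, nsmul_eq_mul, Nat.cast_ofNat] at h2
    rw [← h2]
    exact mul_nonpos_of_nonneg_of_nonpos (D.P.zero_le_rootForm _) hC
  have h4 : 2 * D.P.RootForm σ σ ≤ 0 := by
    have h5 : D.P.RootForm σ σ = ∑ j ∈ D.orb i, D.P.RootForm (D.P.root j) σ := by
      rw [← LinearMap.sum_apply, ← map_sum]
    rw [h5, Finset.mul_sum]
    exact Finset.sum_nonpos h1
  have h5 : D.P.RootForm σ σ = 0 := by
    have := D.P.zero_le_rootForm σ
    omega
  have h6 : σ = 0 := D.P.eq_zero_of_mem_rootSpan_of_rootForm_self_eq_zero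
    (Submodule.sum_mem _ fun j _ => Submodule.subset_span ⟨j, rfl⟩) h5
  have h7 : D.orbitSum i D.base.sumPosCoroot = 0 := by
    have : D.orbitSum i D.base.sumPosCoroot = D.P.toLinearMap σ D.base.sumPosCoroot := by
      rw [orbitSum_apply, hσ, map_sum, LinearMap.sum_apply]
    rw [this, h6, map_zero, LinearMap.zero_apply]
  rw [D.orbitSum_of_galRep_eq D.galRep_sumPosCoroot] at h7
  exact (mul_ne_zero (D.card_orb_pos i).ne' (D.base.root'_sumPosCoroot_ne_zero i)) h7

/-- The two possible shapes of a Galois orbit of roots: as the pairings with `i` of the other roots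
are nonpositive integers and their sum is greater than `-2`, at most one of them is not zero. -/
lemma orbit_dichotomy (i : ι) :
    ((∀ j ∈ D.orb i, ∀ k ∈ D.orb i, j ≠ k → D.P.pairing j k = 0) ∧ D.orbitFactor i = 1 ∧
        ∑ j ∈ D.orb i, D.P.pairing j i = 2) ∨
      ((∃ j ∈ D.orb i, j ≠ i ∧ D.P.pairing j i = -1 ∧
          ∀ l ∈ D.orb i, l ≠ i → l ≠ j → D.P.pairing l i = 0) ∧ D.orbitFactor i = 2 ∧
        ∑ j ∈ D.orb i, D.P.pairing j i = 1) := by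
  classical
  have hpos := D.sum_pairing_pos i
  have hsum := Finset.add_sum_erase _ (fun j => D.P.pairing j i) (D.self_mem_orb i)
  simp only [RootPairing.pairing_same] at hsum
  have hle : ∀ j ∈ (D.orb i).erase i, D.P.pairing j i ≤ 0 := fun j hj =>
    D.pairing_nonpos_of_mem_orb (Finset.mem_of_mem_erase hj) (Finset.ne_of_mem_erase hj)
  by_cases h0 : ∀ j ∈ (D.orb i).erase i, D.P.pairing j i = 0
  · left
    have horth : ∀ j ∈ D.orb i, ∀ k ∈ D.orb i, j ≠ k → D.P.pairing j k = 0 := by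
      intro j hj k hk hjk
      obtain ⟨γ, rfl⟩ := D.mem_orb.1 hk
      rw [← D.pairing_idx γ⁻¹, idx_inv_idx]
      refine h0 _ (Finset.mem_erase.2 ⟨fun h => hjk ?_, (D.idx_mem_orb_iff _ _ _).2 hj⟩)
      rw [← h, idx_idx_inv]
    refine ⟨horth, ?_, ?_⟩
    · rw [orbitFactor, if_pos]
      simpa [orb] using horth
    · rw [← hsum, Finset.sum_eq_zero h0]
      norm_num
  · right
    push Not at h0
    obtain ⟨j, hj, hj0⟩ := h0
    have hsum2 := Finset.add_sum_erase _ (fun j => D.P.pairing j i) hj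
    have hle2 : ∀ l ∈ ((D.orb i).erase i).erase j, D.P.pairing l i ≤ 0 := fun l hl =>
      hle l (Finset.mem_of_mem_erase hl)
    have hS := Finset.sum_nonpos hle2
    have hj1 := hle j hj
    have hS0 : ∑ l ∈ ((D.orb i).erase i).erase j, D.P.pairing l i = 0 := by omega
    have hjo := Finset.mem_of_mem_erase hj
    have hji := Finset.ne_of_mem_erase hj
    refine ⟨⟨j, hjo, hji, by omega, ?_⟩, ?_, by omega⟩
    · intro l hl hli hlj
      exact (Finset.sum_eq_zero_iff_of_nonpos hle2).1 hS0 l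
        (Finset.mem_erase.2 ⟨hlj, Finset.mem_erase.2 ⟨hli, hl⟩⟩)
    · rw [orbitFactor, if_neg]
      intro h
      exact hj0 (h j (by simpa [orb] using hjo) i (by simpa [orb] using D.self_mem_orb i) hji)

lemma orbitSum_coroot (i : ι) :
    D.orbitSum i (D.P.coroot i) = ∑ j ∈ D.orb i, D.P.pairing j i :=
  D.orbitSum_apply i _

lemma relRoot_relCoroot_self (i : ι) : D.relRoot i (D.relCoroot i) = 2 := by
  rw [relCoroot, relRoot_toCoinv, orbitSum_coroot]
  rcases D.orbit_dichotomy i with ⟨-, h1, h2⟩ | ⟨-, h1, h2⟩ <;> rw [h1, h2] <;> norm_num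

/-! ### Relative reflections -/

omit [Finite ι] in
lemma exists_mem_weylGroup_of_orthogonal (s : Finset ι)
    (hs : ∀ j ∈ s, ∀ k ∈ s, j ≠ k → D.P.pairing j k = 0) :
    ∃ w ∈ D.P.weylGroup, ∀ y, coweightRep D.P w y = y - ∑ j ∈ s, D.P.root' j y • D.P.coroot j := by
  classical
  induction s using Finset.induction_on with
  | empty => exact ⟨1, one_mem _, fun y => by simp⟩
  | insert i s his ih =>
    obtain ⟨w, hw, hwy⟩ := ih fun j hj k hk =>
      hs j (Finset.mem_insert_of_mem hj) k (Finset.mem_insert_of_mem hk)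
    refine ⟨_, mul_mem (D.P.reflection_mem_weylGroup i) hw, fun y => ?_⟩
    have h0 : D.P.root' i (∑ j ∈ s, D.P.root' j y • D.P.coroot j) = 0 := by
      rw [map_sum]
      refine Finset.sum_eq_zero fun j hj => ?_
      rw [map_smul, RootPairing.root'_coroot_eq_pairing, hs i (Finset.mem_insert_self _ _) j
        (Finset.mem_insert_of_mem hj) (fun h => his (h ▸ hj)), smul_zero]
    rw [map_mul, Module.End.mul_apply, hwy, coweightRep_reflection, map_sub, h0, sub_zero,
      Finset.sum_insert his]
    abel

/-- The product of the reflections in the roots of a Galois orbit of pairwise orthogonal roots is a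
relative reflection. -/
lemma exists_reflection_of_orthogonal (i : ι)
    (h : ∀ j ∈ D.orb i, ∀ k ∈ D.orb i, j ≠ k → D.P.pairing j k = 0) :
    ∃ w : D.W₀, ∀ y, D.weylAct w (D.toCoinv y) =
      D.toCoinv y - D.orbitSum i y • D.relCoroot i := by
  obtain ⟨w, hw, hwy⟩ := D.exists_mem_weylGroup_of_orthogonal _ h
  have hcomm : ∀ γ, D.act γ * w = w * D.act γ := by
    intro γ
    apply coweightRep_injective
    ext y
    rw [map_mul, map_mul, Module.End.mul_apply, Module.End.mul_apply, hwy, hwy, map_sub, map_sum,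
      ← D.sum_orb_idx γ i (fun j => D.P.root' j _ • D.P.coroot j)]
    congr 1
    refine Finset.sum_congr rfl fun j _ => ?_
    rw [← galRep_eq, map_smul, galRep_coroot, root'_galRep]
  refine ⟨⟨w, hw, Subgroup.mem_centralizer_iff.2 ?_⟩, fun y => ?_⟩
  · rintro _ ⟨γ, rfl⟩
    exact hcomm γ
  · change D.toCoinv (coweightRep D.P w y) = _
    rw [hwy, map_sub, map_sum, orbitSum_apply, Finset.sum_smul]
    congr 1
    refine Finset.sum_congr rfl fun j hj => ?_
    rw [map_zsmul, ← D.relCoroot_eq_of_mem_orb hj, relCoroot]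

/-- If the roots of an orbit are not pairwise orthogonal, the orbit is a union of pairs of roots
spanning a system of type `A₂`, and the sums of these pairs form an orbit of pairwise orthogonal
roots with the same orbit sum. -/
lemma exists_add_orbit {i j : ι} (hj : j ∈ D.orb i) (hji : j ≠ i) (hp : D.P.pairing j i = -1)
    (hl : ∀ l ∈ D.orb i, l ≠ i → l ≠ j → D.P.pairing l i = 0) :
    ∃ k, D.P.coroot k = D.P.coroot i + D.P.coroot j ∧
      (∀ l ∈ D.orb k, ∀ m ∈ D.orb k, l ≠ m → D.P.pairing l m = 0) ∧
      D.orbitSum k = D.orbitSum i := by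
  have horb : D.orb j = D.orb i := by
    obtain ⟨γ, rfl⟩ := D.mem_orb.1 hj
    exact D.orb_idx γ i
  -- the relation between `i` and `j` is symmetric
  obtain ⟨hp', hl'⟩ : D.P.pairing i j = -1 ∧
      ∀ l ∈ D.orb i, l ≠ i → l ≠ j → D.P.pairing l j = 0 := by
    have hne : D.P.pairing i j ≠ 0 := by
      intro h
      rw [D.P.pairing_eq_zero_iff' (i := i) (j := j), hp] at h
      norm_num at h
    have hi : i ∈ D.orb j := horb ▸ D.self_mem_orb i
    rcases D.orbit_dichotomy j with ⟨h, -, -⟩ | ⟨⟨i', -, -, hp2, hl2⟩, -, -⟩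
    · exact absurd (h i hi j (D.self_mem_orb j) hji.symm) hne
    · have : i = i' := by
        by_contra h
        exact hne (hl2 i hi hji.symm h)
      subst this
      exact ⟨hp2, fun l hl h1 h2 => hl2 l (horb ▸ hl) h2 h1⟩
  set k := D.P.reflectionPerm i j with hk
  have hroot : D.P.root k = D.P.root i + D.P.root j := by
    rw [hk, RootPairing.root_reflectionPerm, RootPairing.reflection_apply_root, hp]
    module
  have hcoroot : D.P.coroot k = D.P.coroot i + D.P.coroot j := by
    rw [hk, RootPairing.coroot_reflectionPerm, RootPairing.coreflection_apply_coroot, hp']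
    module
  have hpair : ∀ m, D.P.pairing m k = D.P.pairing m i + D.P.pairing m j := fun m => by
    simp only [RootPairing.pairing, hcoroot, map_add]
  have hroot_idx : ∀ γ, D.P.root (D.idx γ k) = D.P.root (D.idx γ i) + D.P.root (D.idx γ j) := by
    have e : ∀ γ l, D.P.root (D.idx γ l) = D.act γ • D.P.root l := fun γ l =>
      RootPairing.Equiv.root_indexEquiv_eq_smul D.P l (D.act γ)
    intro γ
    rw [e, e, e, hroot, smul_add]
  have hzero : ∀ m ∈ D.orb i, m ≠ i → m ≠ j → D.P.pairing m k = 0 := fun m hm h1 h2 => by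
    rw [hpair, hl m hm h1 h2, hl' m hm h1 h2, add_zero]
  have hi1 : D.P.pairing i k = 1 := by
    rw [hpair, hp', RootPairing.pairing_same]
    norm_num
  have hj1 : D.P.pairing j k = 1 := by
    rw [hpair, hp, RootPairing.pairing_same]
    norm_num
  have hsum : ∀ f : ι → ℤ, ∑ m ∈ D.orb i, D.P.pairing m k * f m = f i + f j := by
    classical
    intro f
    rw [← Finset.sum_subset (s₁ := {i, j}), Finset.sum_pair hji.symm, hi1, hj1, one_mul, one_mul]
    · intro m hm
      rcases Finset.mem_insert.1 hm with rfl | hm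
      · exact D.self_mem_orb m
      · rwa [Finset.mem_singleton.1 hm]
    · intro m hm hm'
      rw [hzero m hm (fun h => hm' (by simp [h])) (fun h => hm' (by simp [h])), zero_mul]
  have hni : ∀ m ∈ D.orb i, D.P.pairing m i = -1 → m = j := by
    intro m hm h
    by_contra hne
    rcases eq_or_ne m i with rfl | h'
    · rw [RootPairing.pairing_same] at h
      norm_num at h
    · rw [hl m hm h' hne] at h
      norm_num at h
  have hnj : ∀ m ∈ D.orb i, D.P.pairing m j = -1 → m = i := by
    intro m hm h
    by_contra hne
    rcases eq_or_ne m j with rfl | h'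
    · rw [RootPairing.pairing_same] at h
      norm_num at h
    · rw [hl' m hm hne h'] at h
      norm_num at h
  have horth : ∀ γ, D.idx γ k ≠ k → D.P.pairing (D.idx γ k) k = 0 := by
    intro γ hne
    have hγi : D.idx γ i ∈ D.orb i := (D.idx_mem_orb_iff γ i i).2 (D.self_mem_orb i)
    have hγj : D.idx γ j ∈ D.orb i := (D.idx_mem_orb_iff γ i j).2 hj
    have hpγ : D.P.pairing (D.idx γ j) (D.idx γ i) = -1 := by rw [pairing_idx, hp]
    have hpγ' : D.P.pairing (D.idx γ i) (D.idx γ j) = -1 := by rw [pairing_idx, hp']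
    have hii : ¬ (D.idx γ i = i ∧ D.idx γ j = j) := by
      rintro ⟨h1, h2⟩
      apply hne
      apply D.P.root.injective
      rw [hroot_idx, h1, h2, hroot]
    have hij : ¬ (D.idx γ i = j ∧ D.idx γ j = i) := by
      rintro ⟨h1, h2⟩
      apply hne
      apply D.P.root.injective
      rw [hroot_idx, h1, h2, hroot, add_comm]
    have h1 : D.idx γ i ≠ i := fun h => hii ⟨h, hni _ hγj (by rwa [h] at hpγ)⟩
    have h2 : D.idx γ i ≠ j := fun h => hij ⟨h, hnj _ hγj (by rwa [h] at hpγ)⟩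
    have h3 : D.idx γ j ≠ i := fun h => hij ⟨hni _ hγi (by rwa [h] at hpγ'), h⟩
    have h4 : D.idx γ j ≠ j := fun h => hii ⟨hnj _ hγi (by rwa [h] at hpγ'), h⟩
    have : D.P.pairing (D.idx γ k) k =
        D.P.pairing (D.idx γ i) k + D.P.pairing (D.idx γ j) k := by
      simp only [RootPairing.pairing, RootPairing.root', hroot_idx, map_add, LinearMap.add_apply]
    rw [this, hzero _ hγi h1 h2, hzero _ hγj h3 h4, add_zero]
  have horth' : ∀ l ∈ D.orb k, ∀ m ∈ D.orb k, l ≠ m → D.P.pairing l m = 0 := by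
    intro l hl m hm hlm
    obtain ⟨γ, rfl⟩ := D.mem_orb.1 hl
    obtain ⟨δ, rfl⟩ := D.mem_orb.1 hm
    rw [← D.pairing_idx δ⁻¹, idx_inv_idx, ← idx_mul]
    refine horth _ fun h => hlm ?_
    rw [idx_mul] at h
    rw [← D.idx_idx_inv δ (D.idx γ k), h]
  refine ⟨k, hcoroot, horth', ?_⟩
  -- both orbit sums are proportional, and they agree on the coroot of `k`
  have hprop : ∀ y, D.orbitSum k y = (∑ b ∈ D.orb k, D.P.pairing i b) * D.orbitSum i y := by
    intro y
    have h1 : ∀ b ∈ D.orb k, D.P.root' b y =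
        ∑ m ∈ D.orb i, D.P.pairing m b * D.P.root' m y := by
      intro b hb
      obtain ⟨γ, rfl⟩ := D.mem_orb.1 hb
      rw [← D.sum_orb_idx γ]
      simp only [pairing_idx]
      rw [hsum fun m => D.P.root' (D.idx γ m) y]
      simp only [RootPairing.root', hroot_idx, map_add, LinearMap.add_apply]
    rw [orbitSum_apply, Finset.sum_congr rfl h1, Finset.sum_comm, orbitSum_apply, Finset.mul_sum]
    refine Finset.sum_congr rfl fun m hm => ?_
    rw [← Finset.sum_mul]
    congr 1
    obtain ⟨γ, rfl⟩ := D.mem_orb.1 hm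
    rw [← D.sum_orb_idx γ]
    exact Finset.sum_congr rfl fun b _ => D.pairing_idx γ i b
  have h1 : D.orbitSum k (D.P.coroot k) = 2 := by
    rw [orbitSum_coroot, Finset.sum_eq_single_of_mem k (D.self_mem_orb k),
      RootPairing.pairing_same]
    exact fun b hb hbk => horth' b hb k (D.self_mem_orb k) hbk
  have h2 : D.orbitSum i (D.P.coroot k) = 2 := by
    rw [orbitSum_apply]
    simpa using hsum 1
  have h3 := hprop (D.P.coroot k)
  rw [h1, h2] at h3
  ext y
  rw [hprop, show ∑ b ∈ D.orb k, D.P.pairing i b = 1 by omega, one_mul]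

/-- Each relative root has a reflection in the relative Weyl group. -/
lemma exists_reflection (i : ι) :
    ∃ w : D.W₀, ∀ z, D.weylAct w z = z - D.relRoot i z • D.relCoroot i := by
  rcases D.orbit_dichotomy i with ⟨h, hf, -⟩ | ⟨⟨j, hj, hji, hp, hl⟩, hf, -⟩
  · obtain ⟨w, hw⟩ := D.exists_reflection_of_orthogonal i h
    refine ⟨w, fun z => ?_⟩
    obtain ⟨y, rfl⟩ := D.toCoinv_surjective z
    rw [hw, relRoot_toCoinv, hf, one_mul]
  · obtain ⟨k, hk, horth, hsum⟩ := D.exists_add_orbit hj hji hp hl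
    obtain ⟨w, hw⟩ := D.exists_reflection_of_orthogonal k horth
    refine ⟨w, fun z => ?_⟩
    obtain ⟨y, rfl⟩ := D.toCoinv_surjective z
    have hc : D.relCoroot k = 2 • D.relCoroot i := by
      rw [relCoroot, hk, map_add, two_smul]
      exact congrArg₂ _ rfl (D.relCoroot_eq_of_mem_orb hj)
    rw [hw, relRoot_toCoinv, hf, hsum, hc, mul_comm, mul_smul]
    congr 2
    exact (natCast_zsmul _ 2).symm

end QuasiSplitRootDatum

namespace QuasiSplitRootDatum

variable {ι X Y Γ : Type*} [AddCommGroup X] [AddCommGroup Y] [Group Γ]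
  (D : QuasiSplitRootDatum ι X Y Γ)

/-! ### The relative Weyl group and the relative roots -/

/-- The permutation of the absolute roots given by an element of the relative Weyl group. -/
abbrev idxW (w : D.W₀) : Equiv.Perm ι := RootPairing.Equiv.indexHom D.P w

lemma idx_idxW (w : D.W₀) (γ : Γ) (i : ι) : D.idx γ (D.idxW w i) = D.idxW w (D.idx γ i) := by
  have h : D.act γ * (w : D.P.Aut) = (w : D.P.Aut) * D.act γ :=
    (Subgroup.mem_centralizer_iff.mp w.2.2) (D.act γ) ⟨γ, rfl⟩
  rw [idx, idxW, ← Equiv.Perm.mul_apply, ← Equiv.Perm.mul_apply, ← map_mul, ← map_mul, h]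

lemma weylAct_toCoinv (w : D.W₀) (y : Y) :
    D.weylAct w (D.toCoinv y) = D.toCoinv (coweightRep D.P w y) := rfl

lemma weylAct_mul_apply (w w' : D.W₀) (z : D.Coinv) :
    D.weylAct (w * w') z = D.weylAct w (D.weylAct w' z) := by
  rw [map_mul]
  rfl

lemma weylAct_relCoroot (w : D.W₀) (i : ι) :
    D.weylAct w (D.relCoroot i) = D.relCoroot (D.idxW w i) := by
  rw [relCoroot, weylAct_toCoinv, coweightRep_coroot, relCoroot]

variable [Finite ι]

lemma idxW_mem_orb_iff (w : D.W₀) (i j : ι) :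
    D.idxW w j ∈ D.orb (D.idxW w i) ↔ j ∈ D.orb i := by
  rw [mem_orb, mem_orb]
  refine exists_congr fun γ => ?_
  rw [idx_idxW]
  exact (D.idxW w).injective.eq_iff

lemma sum_orb_idxW {M : Type*} [AddCommMonoid M] (w : D.W₀) (i : ι) (f : ι → M) :
    ∑ j ∈ D.orb i, f (D.idxW w j) = ∑ j ∈ D.orb (D.idxW w i), f j :=
  Finset.sum_equiv (D.idxW w) (fun j => (D.idxW_mem_orb_iff w i j).symm) fun _ _ => rfl

lemma orbitFactor_eq_three_sub (i : ι) :
    D.orbitFactor i = 3 - ∑ j ∈ D.orb i, D.P.pairing j i := by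
  rcases D.orbit_dichotomy i with ⟨-, h1, h2⟩ | ⟨-, h1, h2⟩ <;> rw [h1, h2] <;> norm_num

lemma orbitFactor_idxW (w : D.W₀) (i : ι) : D.orbitFactor (D.idxW w i) = D.orbitFactor i := by
  rw [orbitFactor_eq_three_sub, orbitFactor_eq_three_sub, ← D.sum_orb_idxW w]
  simp only [pairing_indexHom]

lemma relRoot_weylAct (w : D.W₀) (i : ι) (z : D.Coinv) :
    D.relRoot (D.idxW w i) (D.weylAct w z) = D.relRoot i z := by
  obtain ⟨y, rfl⟩ := D.toCoinv_surjective z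
  rw [weylAct_toCoinv, relRoot_toCoinv, relRoot_toCoinv, orbitFactor_idxW, orbitSum_apply,
    orbitSum_apply, ← D.sum_orb_idxW w]
  simp only [root'_coweightRep]

/-- The relative Weyl group acts faithfully on the coinvariants: an element acting trivially fixes
the values of the roots on the sum of the positive coroots, hence preserves the positive roots. -/
lemma weylAct_injective : Function.Injective D.weylAct := by
  have := Fintype.ofFinite ι
  rw [injective_iff_map_eq_one]
  intro w hw
  set ρ := D.base.sumPosCoroot
  set u := coweightRep D.P w ρ - ρ with hu
  have hu_mem : u ∈ D.coinvKer := by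
    have h : D.toCoinv u = 0 := by
      rw [hu, map_sub, ← weylAct_toCoinv, hw, sub_eq_zero]
      rfl
    exact (QuotientAddGroup.eq_zero_iff _).1 h
  have hu_fix : ∀ γ, D.galRep γ u = u := fun γ => by
    rw [hu, map_sub, ← W₀_comm, galRep_sumPosCoroot]
  -- `u` is orthogonal to the kernel of the projection for the invariant form, which contains `u`
  have horth : ∀ v ∈ D.coinvKer, D.P.CorootForm u v = 0 := by
    suffices h : D.coinvKer ≤ (D.P.CorootForm u).toAddMonoidHom.ker from fun v hv => h hv
    refine (AddSubgroup.closure_le _).2 ?_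
    rintro _ ⟨γ, y, rfl⟩
    change D.P.CorootForm u (D.galRep γ y - y) = 0
    rw [map_sub, sub_eq_zero, RootPairing.corootForm_apply_apply,
      RootPairing.corootForm_apply_apply]
    refine (Fintype.sum_equiv (D.idx γ) _ _ fun i => ?_).symm
    rw [D.root'_galRep, D.root'_idx_of_galRep_eq hu_fix]
  have hroot : ∀ i, D.P.root' i (coweightRep D.P w ρ) = D.P.root' i ρ := by
    intro i
    have h := horth u hu_mem
    rw [RootPairing.corootForm_apply_apply,
      Finset.sum_eq_zero_iff_of_nonneg fun i _ => mul_self_nonneg _] at h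
    have h2 := mul_self_eq_zero.1 (h i (Finset.mem_univ i))
    rwa [hu, map_sub, sub_eq_zero] at h2
  refine Subtype.ext (D.base.eq_one_of_forall_isPos w.2.1 fun i hi => ?_)
  rw [RootPairing.Base.isPos_iff_root'_sumPosCoroot] at hi ⊢
  rwa [← hroot, root'_coweightRep]

/-- The image of the coroot lattice in the coinvariants is torsion free: an element killed by all
relative roots is zero. Indeed, the simple coroots are a basis of the coroot lattice which the
Galois group permutes. -/
lemma eq_zero_of_forall_relRoot_eq_zero {z : D.Coinv}
    (hz : z ∈ Submodule.span ℤ (Set.range D.relCoroot)) (h0 : ∀ l, D.relRoot l z = 0) :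
    z = 0 := by
  classical
  have := Fintype.ofFinite ι
  obtain ⟨n, rfl⟩ : ∃ n : ι → ℤ, z = ∑ i ∈ D.base.support, n i • D.relCoroot i := by
    have h1 : Set.range D.relCoroot = D.toCoinv.toIntLinearMap '' Set.range D.P.coroot := by
      rw [← Set.range_comp]
      rfl
    rw [h1, ← Submodule.map_span, ← D.base.span_int_coroot_support] at hz
    obtain ⟨q, hq, rfl⟩ := hz
    rw [← Finset.coe_image] at hq
    obtain ⟨f, -, rfl⟩ := Submodule.mem_span_finset.1 hq
    refine ⟨fun i => f (D.P.coroot i), ?_⟩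
    rw [Finset.sum_image D.P.coroot.injective.injOn, map_sum]
    exact Finset.sum_congr rfl fun i _ => map_zsmul _ _ _
  have hS : ∀ γ i, D.idx γ i ∈ D.base.support ↔ i ∈ D.base.support := fun γ i =>
    ⟨fun h => by simpa only [idx_inv_idx] using D.act_base γ⁻¹ _ h, D.act_base γ i⟩
  have hSorb : ∀ i ∈ D.base.support, ∀ j ∈ D.orb i, j ∈ D.base.support := by
    intro i hi j hj
    obtain ⟨γ, rfl⟩ := D.mem_orb.1 hj
    exact (hS γ i).2 hi
  have hmem_orb : ∀ i j, j ∈ D.orb i ↔ D.orb j = D.orb i := by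
    intro i j
    refine ⟨fun h => ?_, fun h => h ▸ D.self_mem_orb j⟩
    obtain ⟨γ, rfl⟩ := D.mem_orb.1 h
    exact D.orb_idx γ i
  -- it suffices that the coefficients over each orbit sum up to zero
  suffices hn : ∀ i ∈ D.base.support, ∑ j ∈ D.orb i, n j = 0 by
    refine Finset.sum_cancels_of_partition_cancels (Setoid.ker D.orb) fun i hi => ?_
    have hfilter : {j ∈ D.base.support | Setoid.ker D.orb j i} = D.orb i := by
      ext j
      rw [Finset.mem_filter, Setoid.ker_def, ← hmem_orb]
      exact ⟨And.right, fun h => ⟨hSorb i hi j h, h⟩⟩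
    rw [hfilter, Finset.sum_congr rfl fun j hj => by rw [D.relCoroot_eq_of_mem_orb hj],
      ← Finset.sum_smul, hn i hi, zero_smul]
  -- average the coefficients over the orbits, up to a common multiple of the orbit lengths
  set L : ℕ := (Fintype.card ι).factorial with hL
  have hdvd : ∀ i, (L / (D.orb i).card) * (D.orb i).card = L := fun i =>
    Nat.div_mul_cancel (Nat.dvd_factorial (Finset.card_pos.2 ⟨i, D.self_mem_orb i⟩)
      (Finset.card_le_univ _))
  set k : ι → ℤ := fun i => (L / (D.orb i).card : ℕ) * ∑ j ∈ D.orb i, n j with hk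
  set q : Y := ∑ i ∈ D.base.support, k i • D.P.coroot i with hq
  have hkγ : ∀ γ i, k (D.idx γ i) = k i := fun γ i => by simp only [hk, orb_idx]
  have hqfix : ∀ γ, D.galRep γ q = q := by
    intro γ
    rw [hq, map_sum]
    refine Finset.sum_equiv (D.idx γ) (fun i => (hS γ i).symm) fun i _ => ?_
    rw [map_smul, galRep_coroot, hkγ]
  have hqsum : ∀ l, D.orbitSum l q = 0 := by
    intro l
    have hl : ∑ i ∈ D.base.support, n i * D.orbitSum l (D.P.coroot i) = 0 := by
      have h := h0 l
      have hz : ∑ i ∈ D.base.support, n i • D.relCoroot i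
          = D.toCoinv (∑ i ∈ D.base.support, n i • D.P.coroot i) := by
        rw [map_sum]
        exact Finset.sum_congr rfl fun i _ => (map_zsmul _ _ _).symm
      rw [hz, relRoot_toCoinv, mul_eq_zero, or_iff_right (D.orbitFactor_pos l).ne', map_sum] at h
      simpa using h
    have hconst : ∀ i, ∀ j ∈ D.orb i,
        D.orbitSum l (D.P.coroot j) = D.orbitSum l (D.P.coroot i) := by
      intro i j hj
      obtain ⟨γ, rfl⟩ := D.mem_orb.1 hj
      rw [← galRep_coroot, ← LinearMap.comp_apply, orbitSum_galRep]
    calc D.orbitSum l q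
        = ∑ i ∈ D.base.support, ∑ j ∈ D.orb i,
            (L / (D.orb j).card : ℕ) * (n j * D.orbitSum l (D.P.coroot j)) := by
          rw [hq, map_sum]
          refine Finset.sum_congr rfl fun i _ => ?_
          rw [map_smul, smul_eq_mul, hk, mul_assoc, Finset.sum_mul, Finset.mul_sum]
          refine Finset.sum_congr rfl fun j hj => ?_
          rw [hconst i j hj, (hmem_orb i j).1 hj]
      _ = ∑ j ∈ D.base.support, ∑ i ∈ D.orb j,
            (L / (D.orb j).card : ℕ) * (n j * D.orbitSum l (D.P.coroot j)) := by
          refine Finset.sum_comm' fun i j => ?_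
          rw [hmem_orb, hmem_orb, eq_comm (a := D.orb j)]
          constructor
          · rintro ⟨hi, h⟩
            exact ⟨h, hSorb i hi j ((hmem_orb i j).2 h.symm)⟩
          · rintro ⟨h, hj⟩
            exact ⟨hSorb j hj i ((hmem_orb j i).2 h), h⟩
      _ = L * ∑ j ∈ D.base.support, n j * D.orbitSum l (D.P.coroot j) := by
          rw [Finset.mul_sum]
          refine Finset.sum_congr rfl fun j _ => ?_
          rw [Finset.sum_const, nsmul_eq_mul, ← mul_assoc, ← Nat.cast_mul, mul_comm _ (L / _),
            hdvd]
      _ = 0 := by rw [hl, mul_zero]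
  have hqroot : ∀ l, D.P.root' l q = 0 := by
    intro l
    have h := hqsum l
    rw [D.orbitSum_of_galRep_eq hqfix] at h
    exact (mul_eq_zero.1 h).resolve_left (D.card_orb_pos l).ne'
  have hq0 : q = 0 := by
    refine Submodule.disjoint_def.1 D.P.disjoint_corootSpan_ker_corootForm q ?_ ?_
    · exact Submodule.sum_mem _ fun i _ =>
        Submodule.smul_mem _ _ (Submodule.subset_span ⟨i, rfl⟩)
    · rw [LinearMap.mem_ker]
      ext y
      rw [RootPairing.corootForm_apply_apply]
      exact Finset.sum_eq_zero fun i _ => by rw [hqroot, zero_mul]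
  intro i hi
  have hki : k i = 0 := by
    have hli := linearIndepOn_finset_iff.1 D.base.linearIndepOn_coroot
    exact hli k (hq ▸ hq0) i hi
  refine (mul_eq_zero.1 hki).resolve_left ?_
  intro h
  have h2 := hdvd i
  rw [Nat.cast_eq_zero.1 h, zero_mul] at h2
  exact (Nat.factorial_pos _).ne h2

end QuasiSplitRootDatum

namespace QuasiSplitRootDatum

variable {ι X Y Γ : Type*} [AddCommGroup X] [AddCommGroup Y] [Group Γ]
  (D : QuasiSplitRootDatum ι X Y Γ)

/-! ### The action of the Iwahori-Weyl group on the apartment -/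

/-- The image of an element of the coinvariants in the apartment. -/
abbrev emb (z : D.Coinv) : D.Apartment := (1 : ℝ) ⊗ₜ[ℤ] z

/-- The linear action of the relative Weyl group on the apartment. -/
abbrev linAct (w : D.W₀) : D.Apartment →ₗ[ℝ] D.Apartment :=
  (D.weylAct w).toIntLinearMap.baseChange ℝ

lemma linAct_tmul (w : D.W₀) (r : ℝ) (z : D.Coinv) :
    D.linAct w (r ⊗ₜ[ℤ] z) = r ⊗ₜ[ℤ] D.weylAct w z := rfl

lemma emb_add (y z : D.Coinv) : D.emb (y + z) = D.emb y + D.emb z := TensorProduct.tmul_add _ _ _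

lemma emb_zsmul (n : ℤ) (z : D.Coinv) : D.emb (n • z) = (n : ℝ) • D.emb z := by
  rw [emb, emb, TensorProduct.tmul_smul, Int.cast_smul_eq_zsmul]

lemma linAct_mul (w w' : D.W₀) (v : D.Apartment) :
    D.linAct (w * w') v = D.linAct w (D.linAct w' v) := by
  induction v using TensorProduct.induction_on with
  | zero => simp only [map_zero]
  | tmul r z => rw [linAct_tmul, linAct_tmul, linAct_tmul, weylAct_mul_apply]
  | add a b ha hb => rw [map_add, map_add, map_add, ha, hb]

lemma linAct_one (v : D.Apartment) : D.linAct 1 v = v := by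
  induction v using TensorProduct.induction_on with
  | zero => simp only [map_zero]
  | tmul r z => rw [linAct_tmul, map_one]; rfl
  | add a b ha hb => rw [map_add, ha, hb]

lemma apartmentAct_eq (x : D.IwahoriWeyl) (v : D.Apartment) :
    D.apartmentAct x v = D.linAct x.right v + D.emb x.left.toAdd := rfl

lemma mul_left_toAdd (x y : D.IwahoriWeyl) :
    (x * y).left.toAdd = x.left.toAdd + D.weylAct x.right y.left.toAdd := rfl

lemma apartmentAct_mul (x y : D.IwahoriWeyl) (v : D.Apartment) :
    D.apartmentAct (x * y) v = D.apartmentAct x (D.apartmentAct y v) := by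
  rw [apartmentAct_eq, apartmentAct_eq, apartmentAct_eq, mul_left_toAdd, emb_add,
    SemidirectProduct.mul_right, linAct_mul, map_add, add_assoc, add_comm (D.emb _) (D.emb _)]
  rfl

lemma apartmentAct_one (v : D.Apartment) : D.apartmentAct 1 v = v := by
  rw [apartmentAct_eq, SemidirectProduct.one_right, linAct_one, SemidirectProduct.one_left,
    toAdd_one, emb, TensorProduct.tmul_zero, add_zero]

lemma apartmentAct_inv_apartmentAct (x : D.IwahoriWeyl) (v : D.Apartment) :
    D.apartmentAct x⁻¹ (D.apartmentAct x v) = v := by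
  rw [← apartmentAct_mul, inv_mul_cancel, apartmentAct_one]

lemma apartmentAct_apartmentAct_inv (x : D.IwahoriWeyl) (v : D.Apartment) :
    D.apartmentAct x (D.apartmentAct x⁻¹ v) = v := by
  rw [← apartmentAct_mul, mul_inv_cancel, apartmentAct_one]

variable [Finite ι]

lemma realRoot_tmul (i : ι) (r : ℝ) (z : D.Coinv) :
    D.realRoot i (r ⊗ₜ[ℤ] z) = r * D.relRoot i z := by
  simp only [realRoot, LinearMap.comp_apply, LinearMap.baseChange_tmul]
  change (TensorProduct.AlgebraTensorModule.rid ℤ ℝ ℝ) (r ⊗ₜ[ℤ] D.relRoot i z) = _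
  rw [TensorProduct.AlgebraTensorModule.rid_tmul, zsmul_eq_mul, mul_comm]

lemma realRoot_emb (i : ι) (z : D.Coinv) : D.realRoot i (D.emb z) = D.relRoot i z := by
  rw [emb, realRoot_tmul, one_mul]

lemma realRoot_emb_relCoroot_self (i : ι) : D.realRoot i (D.emb (D.relCoroot i)) = 2 := by
  rw [realRoot_emb, relRoot_relCoroot_self]
  norm_num

lemma realRoot_linAct (w : D.W₀) (i : ι) (v : D.Apartment) :
    D.realRoot (D.idxW w i) (D.linAct w v) = D.realRoot i v := by
  induction v using TensorProduct.induction_on with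
  | zero => simp only [map_zero]
  | tmul r z => rw [linAct_tmul, realRoot_tmul, realRoot_tmul, relRoot_weylAct]
  | add a b ha hb => rw [map_add, map_add, map_add, ha, hb]

lemma realRoot_eq_of_relRoot_eq {i j : ι} {n : ℤ} (h : ∀ z, D.relRoot i z = n * D.relRoot j z)
    (v : D.Apartment) : D.realRoot i v = n * D.realRoot j v := by
  induction v using TensorProduct.induction_on with
  | zero => simp only [map_zero, mul_zero]
  | tmul r z =>
    rw [realRoot_tmul, realRoot_tmul, h]
    push_cast
    ring
  | add a b ha hb => rw [map_add, map_add, ha, hb, mul_add]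

/-- The affine root `relRoot i - k` as an affine function on the apartment. -/
def affRoot (i : ι) (k : ℤ) : D.Apartment →ᵃ[ℝ] ℝ :=
  (D.realRoot i).toAffineMap - AffineMap.const ℝ D.Apartment (k : ℝ)

lemma affRoot_apply (i : ι) (k : ℤ) (v : D.Apartment) :
    D.affRoot i k v = D.realRoot i v - k := rfl

lemma mem_hyperplane_iff (i : ι) (k : ℤ) (v : D.Apartment) :
    v ∈ D.hyperplane i k ↔ D.affRoot i k v = 0 := by
  rw [affRoot_apply, sub_eq_zero]
  rfl

/-- The Iwahori-Weyl group permutes the affine roots. -/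
lemma affRoot_apartmentAct (x : D.IwahoriWeyl) (i : ι) (k : ℤ) (v : D.Apartment) :
    D.affRoot (D.idxW x.right i) (k + D.relRoot (D.idxW x.right i) x.left.toAdd)
      (D.apartmentAct x v) = D.affRoot i k v := by
  rw [affRoot_apply, affRoot_apply, apartmentAct_eq, map_add, realRoot_linAct, realRoot_emb]
  push_cast
  ring

/-! ### Affine reflections -/

lemma exists_isReflection (i : ι) (k : ℤ) : ∃ r, D.IsReflection i k r := by
  obtain ⟨w, hw⟩ := D.exists_reflection i
  exact ⟨⟨Multiplicative.ofAdd (k • D.relCoroot i), w⟩, rfl, hw⟩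

lemma exists_neg (i : ι) : ∃ j, (∀ z, D.relRoot j z = -D.relRoot i z) ∧
    D.relCoroot j = -D.relCoroot i := by
  obtain ⟨w, hw⟩ := D.exists_reflection i
  refine ⟨D.idxW w i, fun z => ?_, ?_⟩
  · have h : D.weylAct w (D.weylAct w z) = z := by
      rw [hw, hw, map_sub, map_zsmul, relRoot_relCoroot_self, smul_eq_mul]
      module
    rw [← h, relRoot_weylAct, h, hw, map_sub, map_zsmul, relRoot_relCoroot_self, smul_eq_mul]
    ring
  · rw [← weylAct_relCoroot, hw, relRoot_relCoroot_self]
    module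

/-- The affine root `-(relRoot i - k)` is also an affine root, with the same reflections. -/
lemma exists_neg_affRoot (i : ι) (k : ℤ) : ∃ j, (∀ v, D.affRoot j (-k) v = -D.affRoot i k v) ∧
    ∀ r, D.IsReflection i k r → D.IsReflection j (-k) r := by
  obtain ⟨j, hj, hj'⟩ := D.exists_neg i
  refine ⟨j, fun v => ?_, fun r hr => ⟨?_, fun y => ?_⟩⟩
  · rw [affRoot_apply, affRoot_apply, D.realRoot_eq_of_relRoot_eq (i := j) (j := i) (n := -1)
      (fun z => by rw [hj, neg_one_mul])]
    push_cast
    ring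
  · rw [hr.1, hj', neg_smul_neg]
  · rw [hr.2, hj, hj', neg_smul_neg]

variable {D}

lemma IsReflection.apartmentAct {i : ι} {k : ℤ} {r : D.IwahoriWeyl} (hr : D.IsReflection i k r)
    (v : D.Apartment) :
    D.apartmentAct r v = v - D.affRoot i k v • D.emb (D.relCoroot i) := by
  have h : ∀ v, D.linAct r.right v = v - D.realRoot i v • D.emb (D.relCoroot i) := by
    intro v
    induction v using TensorProduct.induction_on with
    | zero => simp only [map_zero, zero_smul, sub_zero]
    | tmul s z =>
      rw [linAct_tmul, hr.2, realRoot_tmul, TensorProduct.tmul_sub, mul_smul, ← emb_zsmul, emb,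
        TensorProduct.smul_tmul', smul_eq_mul, mul_one]
    | add a b ha hb =>
      rw [map_add, map_add, ha, hb]
      module
  rw [apartmentAct_eq, h, hr.1, toAdd_ofAdd, emb_zsmul, affRoot_apply]
  module

/-- An affine reflection changes an affine root by a multiple of the reflecting one. -/
lemma IsReflection.affRoot_apartmentAct {i : ι} {k : ℤ} {r : D.IwahoriWeyl}
    (hr : D.IsReflection i k r) (j : ι) (m : ℤ) (v : D.Apartment) :
    D.affRoot j m (D.apartmentAct r v) =
      D.affRoot j m v - D.relRoot j (D.relCoroot i) * D.affRoot i k v := by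
  rw [hr.apartmentAct, affRoot_apply, D.affRoot_apply j m v, map_sub, map_smul, realRoot_emb,
    smul_eq_mul]
  ring

lemma IsReflection.conj {i : ι} {k : ℤ} {r : D.IwahoriWeyl} (hr : D.IsReflection i k r)
    (x : D.IwahoriWeyl) :
    D.IsReflection (D.idxW x.right i) (k + D.relRoot (D.idxW x.right i) x.left.toAdd)
      (x * r * x⁻¹) := by
  set w := x.right with hw
  have hright : (x * r * x⁻¹).right = w * r.right * w⁻¹ := by
    rw [SemidirectProduct.mul_right, SemidirectProduct.mul_right, SemidirectProduct.inv_right]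
  have hcan : ∀ z, D.weylAct w (D.weylAct w⁻¹ z) = z := fun z => by
    rw [← weylAct_mul_apply, mul_inv_cancel, map_one]
    rfl
  have hact : ∀ y, D.weylAct (w * r.right * w⁻¹) y =
      y - D.relRoot (D.idxW w i) y • D.relCoroot (D.idxW w i) := by
    intro y
    rw [weylAct_mul_apply, weylAct_mul_apply, hr.2, map_sub, map_zsmul, hcan, weylAct_relCoroot]
    congr 2
    rw [← D.relRoot_weylAct w i, hcan]
  refine ⟨?_, fun y => ?_⟩
  · -- compare the translation parts in `x r = (x r x⁻¹) x`
    have h : (x * r * x⁻¹ * x).left.toAdd = (x * r).left.toAdd := by rw [inv_mul_cancel_right]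
    rw [D.mul_left_toAdd (x * r * x⁻¹), D.mul_left_toAdd x r, hright, hact, hr.1, toAdd_ofAdd,
      map_zsmul, weylAct_relCoroot, ← hw] at h
    apply Multiplicative.toAdd.injective
    rw [toAdd_ofAdd, add_smul, eq_sub_of_add_eq h]
    abel
  · rw [hright, hact]

lemma IsReflection.mul_self {i : ι} {k : ℤ} {r : D.IwahoriWeyl} (hr : D.IsReflection i k r) :
    r * r = 1 := by
  refine SemidirectProduct.ext ?_ ?_
  · apply Multiplicative.toAdd.injective
    rw [mul_left_toAdd, hr.2, hr.1, toAdd_ofAdd, map_zsmul, relRoot_relCoroot_self,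
      SemidirectProduct.one_left, toAdd_one, smul_eq_mul]
    module
  · apply D.weylAct_injective
    rw [SemidirectProduct.mul_right, SemidirectProduct.one_right, map_one]
    ext y
    obtain ⟨y, rfl⟩ := D.toCoinv_surjective y
    change D.weylAct (r.right * r.right) _ = _
    rw [weylAct_mul_apply, hr.2, hr.2, map_sub, map_zsmul, relRoot_relCoroot_self, smul_eq_mul]
    change _ = D.toCoinv y
    module

variable (D)

/-- An invariant symmetric bilinear form on the apartment. -/
def form (u v : D.Apartment) : ℝ :=
  letI := Fintype.ofFinite ι
  ∑ l, D.realRoot l u * D.realRoot l v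

lemma form_add_left (u u' v : D.Apartment) : D.form (u + u') v = D.form u v + D.form u' v := by
  simp only [form, map_add, add_mul, Finset.sum_add_distrib]

lemma form_smul_left (a : ℝ) (u v : D.Apartment) : D.form (a • u) v = a * D.form u v := by
  simp only [form, map_smul, smul_eq_mul, mul_assoc, Finset.mul_sum]

lemma form_comm (u v : D.Apartment) : D.form u v = D.form v u := by
  simp only [form, mul_comm]

lemma form_sub_left (u u' v : D.Apartment) : D.form (u - u') v = D.form u v - D.form u' v := by
  rw [sub_eq_add_neg, ← neg_one_smul ℝ u', form_add_left, form_smul_left]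
  ring

lemma form_sub_right (u v v' : D.Apartment) : D.form u (v - v') = D.form u v - D.form u v' := by
  rw [form_comm, form_sub_left, D.form_comm v, D.form_comm v']

lemma form_smul_right (a : ℝ) (u v : D.Apartment) : D.form u (a • v) = a * D.form u v := by
  rw [form_comm, form_smul_left, form_comm]

lemma form_linAct (w : D.W₀) (u v : D.Apartment) :
    D.form (D.linAct w u) (D.linAct w v) = D.form u v := by
  let _ := Fintype.ofFinite ι
  refine (Fintype.sum_equiv (D.idxW w) _ _ fun l => ?_).symm
  rw [realRoot_linAct, realRoot_linAct]

lemma form_relCoroot_self_pos (i : ι) :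
    0 < D.form (D.emb (D.relCoroot i)) (D.emb (D.relCoroot i)) := by
  let _ := Fintype.ofFinite ι
  refine Finset.sum_pos' (fun l _ => mul_self_nonneg _) ⟨i, Finset.mem_univ i, ?_⟩
  rw [realRoot_emb_relCoroot_self]
  norm_num

/-- The relative coroots are dual to the relative roots with respect to the invariant form. -/
lemma two_mul_form_relCoroot (i : ι) (v : D.Apartment) :
    2 * D.form (D.emb (D.relCoroot i)) v =
      D.realRoot i v * D.form (D.emb (D.relCoroot i)) (D.emb (D.relCoroot i)) := by
  obtain ⟨r, hr⟩ := D.exists_isReflection i 0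
  have h : ∀ v, D.linAct r.right v = v - D.realRoot i v • D.emb (D.relCoroot i) := by
    intro v
    have := hr.apartmentAct v
    rw [apartmentAct_eq, hr.1, zero_smul, toAdd_ofAdd, emb, TensorProduct.tmul_zero, add_zero,
      affRoot_apply, Int.cast_zero, sub_zero] at this
    exact this
  have h2 := D.form_linAct r.right (D.emb (D.relCoroot i)) v
  rw [h, h, realRoot_emb_relCoroot_self, form_sub_left, form_sub_right, form_sub_right,
    form_smul_left, form_smul_left, form_smul_right] at h2
  linarith

/-- If two relative roots are proportional, then their coroots are inversely proportional, in the
coinvariants themselves and not only up to torsion. -/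
lemma zsmul_relCoroot_eq {i j : ι} {c : ℝ} (hc : ∀ v, D.realRoot j v = c * D.realRoot i v)
    {p q : ℤ} (hpq : (q : ℝ) = c * p) : p • D.relCoroot i = q • D.relCoroot j := by
  set a := D.emb (D.relCoroot i) with ha
  set b := D.emb (D.relCoroot j) with hb
  have h1 : D.form a a = c ^ 2 * D.form b b := by
    have e1 := D.two_mul_form_relCoroot i b
    have e2 := D.two_mul_form_relCoroot j a
    have e3 : D.realRoot i a = 2 := D.realRoot_emb_relCoroot_self i
    have e4 : D.realRoot j b = 2 := D.realRoot_emb_relCoroot_self j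
    rw [← ha, D.form_comm a b] at e1
    rw [← hb, hc, e3] at e2
    rw [hc] at e4
    linear_combination (c / 2) * e2 - (c / 2) * e1 - (D.form a a / 2) * e4
  rw [← sub_eq_zero]
  refine D.eq_zero_of_forall_relRoot_eq_zero (sub_mem ?_ ?_) fun l => ?_
  · exact Submodule.smul_mem _ _ (Submodule.subset_span ⟨i, rfl⟩)
  · exact Submodule.smul_mem _ _ (Submodule.subset_span ⟨j, rfl⟩)
  · set z := p • D.relCoroot i - q • D.relCoroot j with hz
    have hez : D.emb z = (p : ℝ) • a - (q : ℝ) • b := by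
      rw [ha, hb, ← emb_zsmul, ← emb_zsmul, hz, emb, TensorProduct.tmul_sub]
    have hform : D.form (D.emb z) (D.emb z) = 0 := by
      have e1 := D.two_mul_form_relCoroot i (D.emb z)
      have e2 := D.two_mul_form_relCoroot j (D.emb z)
      rw [hc] at e2
      nth_rw 1 [hez]
      rw [form_sub_left, form_smul_left, form_smul_left]
      rw [← ha, h1] at e1
      rw [← hb] at e2
      linear_combination (p / 2 : ℝ) * e1 - (q / 2 : ℝ) * e2 -
        (c / 2 * D.realRoot i (D.emb z) * D.form b b) * hpq
    let _ := Fintype.ofFinite ι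
    have h2 := (Finset.sum_eq_zero_iff_of_nonneg
      (fun l _ => mul_self_nonneg (D.realRoot l (D.emb z)))).1 hform l (Finset.mem_univ l)
    rw [mul_self_eq_zero, realRoot_emb] at h2
    exact_mod_cast h2

/-- Affine roots which vanish on the same hyperplane are proportional. -/
lemma exists_affRoot_eq_mul {i j : ι} {k m : ℤ}
    (h : ∀ v, D.affRoot i k v = 0 → D.affRoot j m v = 0) :
    ∃ c : ℝ, ∀ v, D.affRoot j m v = c * D.affRoot i k v := by
  -- project `v` onto the hyperplane along the coroot
  have ha := D.realRoot_emb_relCoroot_self i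
  refine ⟨D.realRoot j (D.emb (D.relCoroot i)) / 2, fun v => ?_⟩
  have := h (v - ((D.realRoot i v - k) / 2) • D.emb (D.relCoroot i)) (by
    rw [affRoot_apply, map_sub, map_smul, ha, smul_eq_mul]
    ring)
  rw [affRoot_apply, map_sub, map_smul, smul_eq_mul] at this
  rw [affRoot_apply, affRoot_apply]
  linarith

variable {D}

/-- The affine reflection in a hyperplane is unique. -/
lemma IsReflection.unique {i j : ι} {k m : ℤ} {r r' : D.IwahoriWeyl} (hr : D.IsReflection i k r)
    (hr' : D.IsReflection j m r')
    (h : ∀ v, D.affRoot i k v = 0 → D.affRoot j m v = 0) : r = r' := by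
  obtain ⟨c, hprop⟩ := D.exists_affRoot_eq_mul h
  simp only [affRoot_apply] at hprop
  have hm : (m : ℝ) = c * k := by
    have h0 := hprop 0
    simp only [map_zero] at h0
    linarith
  have hc : ∀ v, D.realRoot j v = c * D.realRoot i v := fun v => by
    linear_combination hprop v + hm
  refine SemidirectProduct.ext ?_ (D.weylAct_injective ?_)
  · rw [hr.1, hr'.1, D.zsmul_relCoroot_eq hc hm]
  · refine AddMonoidHom.ext fun y => ?_
    have e : D.relRoot i y • D.relCoroot i = D.relRoot j y • D.relCoroot j := by
      refine D.zsmul_relCoroot_eq hc ?_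
      rw [← realRoot_emb, ← realRoot_emb, hc]
    refine (hr.2 y).trans ?_
    rw [e]
    exact (hr'.2 y).symm

end QuasiSplitRootDatum

/-! ### Generic points -/

open Filter Topology in
/-- Finitely many strict affine inequalities which are satisfied by some point are also satisfied by
a point off the zero sets of finitely many given nonzero affine functions. -/
lemma exists_forall_pos_forall_ne_zero {V : Type*} [AddCommGroup V] [Module ℝ V]
    (B A : Finset (V →ᵃ[ℝ] ℝ)) (v₀ : V) (hB : ∀ f ∈ B, 0 < f v₀) (hA : ∀ g ∈ A, ∃ u, g u ≠ 0) :
    ∃ v, (∀ f ∈ B, 0 < f v) ∧ ∀ g ∈ A, g v ≠ 0 := by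
  classical
  induction A using Finset.induction_on with
  | empty => exact ⟨v₀, hB, by simp⟩
  | insert g A _ ih =>
    obtain ⟨v, hv, hv'⟩ := ih fun g hg => hA g (Finset.mem_insert_of_mem hg)
    by_cases hgv : g v = 0
    swap
    · refine ⟨v, hv, fun f hf => ?_⟩
      rcases Finset.mem_insert.1 hf with rfl | hf
      exacts [hgv, hv' f hf]
    obtain ⟨u, hu⟩ := hA g (Finset.mem_insert_self _ _)
    -- move slightly from `v` towards `u`
    have hcont : ∀ f : V →ᵃ[ℝ] ℝ,
        Tendsto (fun ε : ℝ => f (AffineMap.lineMap v u ε)) (𝓝[>] 0) (𝓝 (f v)) := by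
      intro f
      have h : Continuous fun ε : ℝ => f (AffineMap.lineMap v u ε) := by
        simp only [AffineMap.apply_lineMap, AffineMap.lineMap_apply_ring']
        fun_prop
      have h2 := h.tendsto 0
      simp only [AffineMap.lineMap_apply_zero] at h2
      exact h2.mono_left nhdsWithin_le_nhds
    have h1 : ∀ᶠ ε in 𝓝[>] (0 : ℝ), ∀ f ∈ B, 0 < f (AffineMap.lineMap v u ε) :=
      (eventually_all_finset B).2 fun f hf => (hcont f).eventually (lt_mem_nhds (hv f hf))
    have h2 : ∀ᶠ ε in 𝓝[>] (0 : ℝ), ∀ f ∈ A, f (AffineMap.lineMap v u ε) ≠ 0 :=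
      (eventually_all_finset A).2 fun f hf => (hcont f).eventually_ne (hv' f hf)
    obtain ⟨ε, ⟨h1, h2⟩, hε⟩ := ((h1.and h2).and self_mem_nhdsWithin).exists
    refine ⟨AffineMap.lineMap v u ε, h1, fun f hf => ?_⟩
    rcases Finset.mem_insert.1 hf with rfl | hf
    · rw [AffineMap.apply_lineMap, AffineMap.lineMap_apply_ring', hgv, add_zero, sub_zero]
      exact mul_ne_zero (ne_of_gt hε) hu
    · exact h2 f hf

namespace QuasiSplitRootDatum

variable {ι X Y Γ : Type*} [AddCommGroup X] [AddCommGroup Y] [Group Γ]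
  (D : QuasiSplitRootDatum ι X Y Γ) [Finite ι]

/-! ### The base alcove -/

omit [Finite ι] in
lemma isPos_iff (i : ι) : D.IsPos i ↔ D.base.IsPos i :=
  (D.base.isPos_iff_mem_closure i).symm

lemma isPos_iff_relRoot_pos (i : ι) :
    D.IsPos i ↔ 0 < D.relRoot i (D.toCoinv D.base.sumPosCoroot) := by
  rw [isPos_iff, RootPairing.Base.isPos_iff_root'_sumPosCoroot, relRoot_toCoinv,
    D.orbitSum_of_galRep_eq D.galRep_sumPosCoroot, mul_pos_iff_of_pos_left (D.orbitFactor_pos i),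
    mul_pos_iff_of_pos_left (D.card_orb_pos i)]

lemma relRoot_sumPosCoroot_ne_zero (i : ι) :
    D.relRoot i (D.toCoinv D.base.sumPosCoroot) ≠ 0 := by
  rw [relRoot_toCoinv, D.orbitSum_of_galRep_eq D.galRep_sumPosCoroot]
  exact mul_ne_zero (D.orbitFactor_pos i).ne'
    (mul_ne_zero (D.card_orb_pos i).ne' (D.base.root'_sumPosCoroot_ne_zero i))

/-- Each affine root or its negative has a positive gradient. -/
lemma exists_isPos_affRoot (i : ι) (k : ℤ) : D.IsPos i ∨
    ∃ j, D.IsPos j ∧ ∀ v, D.affRoot i k v = -D.affRoot j (-k) v := by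
  refine or_iff_not_imp_left.2 fun hi => ?_
  obtain ⟨j, hj, -⟩ := D.exists_neg i
  have h := D.relRoot_sumPosCoroot_ne_zero i
  refine ⟨j, ?_, fun v => ?_⟩
  · rw [isPos_iff_relRoot_pos] at hi ⊢
    rw [hj]
    omega
  · rw [affRoot_apply, affRoot_apply, D.realRoot_eq_of_relRoot_eq (i := j) (j := i) (n := -1)
      (fun z => by rw [hj, neg_one_mul])]
    push_cast
    ring

/-- A small multiple of the sum of the positive coroots lies in the base alcove. -/
lemma alcove_nonempty : D.alcove.Nonempty := by
  obtain ⟨M, hM⟩ : ∃ M : ℤ, ∀ i, D.relRoot i (D.toCoinv D.base.sumPosCoroot) < M := by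
    obtain ⟨M, hM⟩ := (Set.finite_range fun i =>
      D.relRoot i (D.toCoinv D.base.sumPosCoroot)).bddAbove
    exact ⟨M + 1, fun i => Int.lt_add_one_iff.2 (hM ⟨i, rfl⟩)⟩
  refine ⟨(M : ℝ)⁻¹ ⊗ₜ D.toCoinv D.base.sumPosCoroot, fun i hi => ?_⟩
  have h1 : (0 : ℝ) < D.relRoot i (D.toCoinv D.base.sumPosCoroot) :=
    Int.cast_pos.2 ((D.isPos_iff_relRoot_pos i).1 hi)
  have h2 : (D.relRoot i (D.toCoinv D.base.sumPosCoroot) : ℝ) < M := Int.cast_lt.2 (hM i)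
  have h3 : (0 : ℝ) < M := h1.trans h2
  rw [realRoot_tmul, inv_mul_lt_one₀ h3]
  exact ⟨mul_pos (inv_pos.2 h3) h1, h2⟩

/-- A point of the closed alcove lies on the same side of each affine root hyperplane as the points
of the alcove, or on the hyperplane. -/
lemma sign_affRoot_eq_of_mem_closedAlcove {u v : D.Apartment} (hu : u ∈ D.closedAlcove)
    (hv : v ∈ D.alcove) (i : ι) (k : ℤ) (h0 : D.affRoot i k u ≠ 0) :
    SignType.sign (D.affRoot i k u) = SignType.sign (D.affRoot i k v) := by
  have key : ∀ i k, D.IsPos i → D.affRoot i k u ≠ 0 →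
      SignType.sign (D.affRoot i k u) = SignType.sign (D.affRoot i k v) := by
    intro i k hi h0
    obtain ⟨h1, h2⟩ := hu i hi
    obtain ⟨h3, h4⟩ := hv i hi
    rw [affRoot_apply] at h0 ⊢
    rw [affRoot_apply]
    rcases le_or_gt k 0 with hk | hk
    · have hk' : (k : ℝ) ≤ 0 := by exact_mod_cast hk
      rw [sign_pos (lt_of_le_of_ne (by linarith) h0.symm), sign_pos (by linarith)]
    · have hk' : (1 : ℝ) ≤ k := by exact_mod_cast hk
      rw [sign_neg (lt_of_le_of_ne (by linarith) h0), sign_neg (by linarith)]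
  rcases D.exists_isPos_affRoot i k with hi | ⟨j, hj, h⟩
  · exact key i k hi h0
  · rw [h, neg_ne_zero] at h0
    rw [h, h, Left.sign_neg, Left.sign_neg, key j (-k) hj h0]

lemma alcove_subset_closedAlcove : D.alcove ⊆ D.closedAlcove := fun _ hv i hi =>
  ⟨(hv i hi).1.le, (hv i hi).2.le⟩

lemma affRoot_ne_zero_of_mem_alcove {v : D.Apartment} (hv : v ∈ D.alcove) (i : ι) (k : ℤ) :
    D.affRoot i k v ≠ 0 := by
  have key : ∀ i k, D.IsPos i → D.affRoot i k v ≠ 0 := by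
    intro i k hi h
    obtain ⟨h3, h4⟩ := hv i hi
    rw [affRoot_apply, sub_eq_zero] at h
    rw [h] at h3 h4
    have h3' : 0 < k := by exact_mod_cast h3
    have h4' : k < 1 := by exact_mod_cast h4
    omega
  rcases D.exists_isPos_affRoot i k with hi | ⟨j, hj, h⟩
  · exact key i k hi
  · rw [h, neg_ne_zero]
    exact key j (-k) hj

lemma sign_affRoot_eq_of_mem_alcove {u v : D.Apartment} (hu : u ∈ D.alcove)
    (hv : v ∈ D.alcove) (i : ι) (k : ℤ) :
    SignType.sign (D.affRoot i k u) = SignType.sign (D.affRoot i k v) :=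
  D.sign_affRoot_eq_of_mem_closedAlcove (D.alcove_subset_closedAlcove hu) hv i k
    (D.affRoot_ne_zero_of_mem_alcove hu i k)

lemma mem_alcove_of_sign_affRoot_eq {u v : D.Apartment} (hv : v ∈ D.alcove)
    (h : ∀ i k, SignType.sign (D.affRoot i k u) = SignType.sign (D.affRoot i k v)) :
    u ∈ D.alcove := by
  intro i hi
  obtain ⟨h1, h2⟩ := hv i hi
  have h3 := h i 0
  have h4 := h i 1
  simp only [affRoot_apply, Int.cast_zero, sub_zero, Int.cast_one] at h3 h4
  rw [sign_pos h1, sign_eq_one_iff] at h3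
  rw [sign_neg (sub_neg.2 h2), sign_eq_neg_one_iff, sub_neg] at h4
  exact ⟨h3, h4⟩

/-- Only finitely many affine roots separate two given points. -/
lemma finite_separating (u v : D.Apartment) :
    {a : ι × ℤ | 0 < D.affRoot a.1 a.2 u ∧ D.affRoot a.1 a.2 v ≤ 0}.Finite := by
  refine (Set.finite_iUnion fun i : ι =>
    ((Set.finite_Icc ⌊D.realRoot i v⌋ ⌈D.realRoot i u⌉).image (Prod.mk i))).subset ?_
  rintro ⟨i, k⟩ ⟨h1, h2⟩
  rw [affRoot_apply, sub_pos] at h1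
  rw [affRoot_apply, sub_nonpos] at h2
  refine Set.mem_iUnion.2 ⟨i, k, ⟨?_, ?_⟩, rfl⟩
  · exact Int.cast_le (R := ℝ).1 ((Int.floor_le _).trans h2)
  · exact Int.cast_le (R := ℝ).1 (h1.le.trans (Int.le_ceil _))

/-- A point of the alcove and a point off all hyperplanes which are separated by some affine root
hyperplane are separated by a wall of the alcove: the first hyperplane met on the segment from a
generic point of the alcove. -/
lemma exists_isWall {v₀ p : D.Apartment} (hv₀ : v₀ ∈ D.alcove)
    (hp : ∀ i k, D.affRoot i k p ≠ 0) {i₀ : ι} {k₀ : ℤ} (h₀ : 0 < D.affRoot i₀ k₀ v₀)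
    (hp₀ : D.affRoot i₀ k₀ p < 0) :
    ∃ i k, D.IsWall i k ∧ 0 < D.affRoot i k v₀ ∧ D.affRoot i k p < 0 := by
  classical
  let _ := Fintype.ofFinite ι
  -- the separating affine roots
  have hfin : {a : ι × ℤ | 0 < D.affRoot a.1 a.2 v₀ ∧ D.affRoot a.1 a.2 p < 0}.Finite :=
    (D.finite_separating v₀ p).subset fun _ ha => ⟨ha.1, ha.2.le⟩
  set F := hfin.toFinset with hF
  have hFmem : ∀ a, a ∈ F ↔ 0 < D.affRoot a.1 a.2 v₀ ∧ D.affRoot a.1 a.2 p < 0 := fun a => by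
    simp [hF]
  -- the segment to `p` from a point off the zero set of `g a b` meets `a` and `b` at
  -- different points
  let g : (ι × ℤ) × (ι × ℤ) → (D.Apartment →ᵃ[ℝ] ℝ) := fun c =>
    D.affRoot c.1.1 c.1.2 p • D.affRoot c.2.1 c.2.2 -
      D.affRoot c.2.1 c.2.2 p • D.affRoot c.1.1 c.1.2
  have hg : ∀ a b v, g (a, b) v =
      D.affRoot a.1 a.2 p * D.affRoot b.1 b.2 v - D.affRoot b.1 b.2 p * D.affRoot a.1 a.2 v :=
    fun a b v => rfl
  obtain ⟨v₁, hB, hA⟩ := exists_forall_pos_forall_ne_zero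
    (Finset.univ.image (fun i : ι => if D.IsPos i then D.affRoot i 0 else AffineMap.const ℝ _ 1) ∪
      Finset.univ.image (fun i : ι => if D.IsPos i then - D.affRoot i 1 else AffineMap.const ℝ _ 1))
    (((F ×ˢ F).image g).filter fun f => ∃ u, f u ≠ 0) v₀ (by
      intro f hf
      rcases Finset.mem_union.1 hf with hf | hf <;>
      · obtain ⟨i, -, rfl⟩ := Finset.mem_image.1 hf
        split_ifs with hi
        · obtain ⟨h1, h2⟩ := hv₀ i hi
          simp only [AffineMap.coe_neg, Pi.neg_apply, affRoot_apply]
          push_cast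
          linarith
        · exact one_pos) (fun f hf => (Finset.mem_filter.1 hf).2)
  have hv₁ : v₁ ∈ D.alcove := by
    intro i hi
    have h1 := hB _ (Finset.mem_union_left _ (Finset.mem_image_of_mem _ (Finset.mem_univ i)))
    have h2 := hB _ (Finset.mem_union_right _ (Finset.mem_image_of_mem _ (Finset.mem_univ i)))
    simp only [if_pos hi, AffineMap.coe_neg, Pi.neg_apply, affRoot_apply] at h1 h2
    push_cast at h1 h2
    constructor <;> linarith
  have hsgn : ∀ i k, 0 < D.affRoot i k v₀ ↔ 0 < D.affRoot i k v₁ := fun i k => by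
    rw [← sign_eq_one_iff, ← sign_eq_one_iff, D.sign_affRoot_eq_of_mem_alcove hv₀ hv₁]
  -- the parameter at which the segment meets a separating hyperplane
  let t : ι × ℤ → ℝ := fun a =>
    D.affRoot a.1 a.2 v₁ / (D.affRoot a.1 a.2 v₁ - D.affRoot a.1 a.2 p)
  obtain ⟨a, ha, hmin⟩ := F.exists_min_image t ⟨(i₀, k₀), (hFmem _).2 ⟨h₀, hp₀⟩⟩
  obtain ⟨ha0, hap⟩ := (hFmem a).1 ha
  have ha1 := (hsgn _ _).1 ha0
  have hden : 0 < D.affRoot a.1 a.2 v₁ - D.affRoot a.1 a.2 p := by linarith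
  have hta : t a * (D.affRoot a.1 a.2 v₁ - D.affRoot a.1 a.2 p) = D.affRoot a.1 a.2 v₁ :=
    div_mul_cancel₀ _ hden.ne'
  have ht0 : 0 < t a := div_pos ha1 hden
  have ht1 : t a < 1 := (div_lt_one hden).2 (by linarith)
  set v := AffineMap.lineMap v₁ p (t a) with hv
  have hval : ∀ i k, D.affRoot i k v =
      t a * (D.affRoot i k p - D.affRoot i k v₁) + D.affRoot i k v₁ := fun i k => by
    rw [hv, AffineMap.apply_lineMap, AffineMap.lineMap_apply_ring']
  have hav : D.affRoot a.1 a.2 v = 0 := by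
    rw [hval]
    linarith
  have hnonneg : ∀ i k, 0 < D.affRoot i k v₁ → 0 ≤ D.affRoot i k v ∧
      (D.affRoot i k v = 0 → (i, k) ∈ F ∧ t (i, k) = t a) := by
    intro i k hik
    rw [hval]
    rcases (hp i k).lt_or_gt with hneg | hpos
    · have hmem : (i, k) ∈ F := (hFmem _).2 ⟨(hsgn i k).2 hik, hneg⟩
      have hle := hmin _ hmem
      have hd : 0 < D.affRoot i k v₁ - D.affRoot i k p := by linarith
      have ht : t (i, k) * (D.affRoot i k v₁ - D.affRoot i k p) = D.affRoot i k v₁ :=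
        div_mul_cancel₀ _ hd.ne'
      refine ⟨by nlinarith, fun h => ⟨hmem, ?_⟩⟩
      exact mul_right_cancel₀ hd.ne' (by linarith)
    · have h3 : 0 < t a * D.affRoot i k p := mul_pos ht0 hpos
      have h4 : 0 < (1 - t a) * D.affRoot i k v₁ := mul_pos (by linarith) hik
      exact ⟨by linarith, fun h => by linarith⟩
  have hsame : ∀ i k, 0 < D.affRoot i k v₁ → D.affRoot i k v = 0 →
      D.hyperplane i k = D.hyperplane a.1 a.2 := by
    intro i k hik h
    obtain ⟨hmem, ht⟩ := (hnonneg i k hik).2 h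
    obtain ⟨-, hbp⟩ := (hFmem _).1 hmem
    have hd : 0 < D.affRoot i k v₁ - D.affRoot i k p := by linarith
    have htb : t (i, k) * (D.affRoot i k v₁ - D.affRoot i k p) = D.affRoot i k v₁ :=
      div_mul_cancel₀ _ hd.ne'
    have hg1 : g (a, (i, k)) v₁ = 0 := by
      rw [hg]
      rw [ht] at htb
      change D.affRoot a.1 a.2 p * D.affRoot i k v₁ - D.affRoot i k p * D.affRoot a.1 a.2 v₁ = 0
      have ht1' : 1 - t a ≠ 0 := by linarith
      apply mul_left_cancel₀ ht1'
      have e1 : (1 - t a) * D.affRoot i k v₁ = - t a * D.affRoot i k p := by linarith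
      have e2 : (1 - t a) * D.affRoot a.1 a.2 v₁ = - t a * D.affRoot a.1 a.2 p := by linarith
      linear_combination D.affRoot a.1 a.2 p * e1 - D.affRoot i k p * e2
    have hg0 : ∀ u, g (a, (i, k)) u = 0 := by
      by_contra hne
      push Not at hne
      exact hA _ (Finset.mem_filter.2 ⟨Finset.mem_image_of_mem g
        (Finset.mem_product.2 ⟨ha, hmem⟩), hne⟩) hg1
    ext u
    rw [mem_hyperplane_iff, mem_hyperplane_iff]
    have hu := hg0 u
    rw [hg] at hu
    change D.affRoot a.1 a.2 p * D.affRoot i k u - D.affRoot i k p * D.affRoot a.1 a.2 u = 0 at hu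
    constructor
    · intro h
      rw [h, mul_zero, zero_sub, neg_eq_zero] at hu
      exact (mul_eq_zero.1 hu).resolve_left hbp.ne
    · intro h
      rw [h, mul_zero, sub_zero] at hu
      exact (mul_eq_zero.1 hu).resolve_left hap.ne
  refine ⟨a.1, a.2, ⟨v, (D.mem_hyperplane_iff _ _ _).2 hav, ?_, ?_⟩, ha0, hap⟩
  · intro i hi
    obtain ⟨h1, h2⟩ := hv₁ i hi
    obtain ⟨j, hj, -⟩ := D.exists_neg_affRoot i 1
    have h3 := (hnonneg i 0 (by rw [affRoot_apply, Int.cast_zero, sub_zero]; exact h1)).1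
    have h4 := (hnonneg j (-1) (by
      rw [hj, affRoot_apply, Int.cast_one]
      linarith)).1
    rw [hj, affRoot_apply, Int.cast_one] at h4
    rw [affRoot_apply, Int.cast_zero] at h3
    constructor <;> linarith
  · intro j m hjm
    rw [mem_hyperplane_iff] at hjm
    rcases (D.affRoot_ne_zero_of_mem_alcove hv₁ j m).lt_or_gt with h | h
    · obtain ⟨j', hj', -⟩ := D.exists_neg_affRoot j m
      rw [← hsame j' (-m) (by rw [hj']; linarith) (by rw [hj', hjm, neg_zero])]
      ext u
      rw [mem_hyperplane_iff, mem_hyperplane_iff, hj', neg_eq_zero]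
    · exact hsame j m h hjm

end QuasiSplitRootDatum

namespace QuasiSplitRootDatum

variable {ι X Y Γ : Type*} [AddCommGroup X] [AddCommGroup Y] [Group Γ]
  (D : QuasiSplitRootDatum ι X Y Γ) [Finite ι]

/-! ### Half-apartments -/

/-- A half-apartment, encoded by the sign function of an affine root. Proportional affine roots
define the same hyperplane and must not be counted twice, so they are identified here. -/
def HalfApartment : Type _ :=
  {σ : D.Apartment → SignType // ∃ i k, σ = fun v => SignType.sign (D.affRoot i k v)}

/-- The half-apartment on which an affine root is positive. -/
def half (i : ι) (k : ℤ) : D.HalfApartment :=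
  ⟨fun v => SignType.sign (D.affRoot i k v), i, k, rfl⟩

lemma exists_eq_half (σ : D.HalfApartment) : ∃ i k, σ = D.half i k := by
  obtain ⟨σ, i, k, h⟩ := σ
  exact ⟨i, k, Subtype.ext h⟩

lemma half_eq_half_iff {i j : ι} {k m : ℤ} : D.half i k = D.half j m ↔
    ∀ v, SignType.sign (D.affRoot i k v) = SignType.sign (D.affRoot j m v) :=
  ⟨fun h v => congrFun (Subtype.ext_iff.1 h) v, fun h => Subtype.ext (funext h)⟩

/-- The action of the Iwahori-Weyl group on the half-apartments. -/
def halfAct : D.IwahoriWeyl →* Equiv.Perm D.HalfApartment :=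
  let f : D.IwahoriWeyl → D.HalfApartment → D.HalfApartment := fun x σ =>
    ⟨fun v => σ.1 (D.apartmentAct x⁻¹ v), by
      obtain ⟨i, k, rfl⟩ := D.exists_eq_half σ
      refine ⟨D.idxW x.right i, k + D.relRoot (D.idxW x.right i) x.left.toAdd, funext fun v => ?_⟩
      change SignType.sign (D.affRoot i k _) = _
      rw [← D.affRoot_apartmentAct x, apartmentAct_apartmentAct_inv]⟩
  have hf1 : ∀ σ, f 1 σ = σ := fun σ => Subtype.ext (funext fun v => by
    change σ.1 (D.apartmentAct 1⁻¹ v) = σ.1 v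
    rw [inv_one, apartmentAct_one])
  have hfm : ∀ x y σ, f (x * y) σ = f x (f y σ) := fun x y σ => Subtype.ext (funext fun v => by
    change σ.1 (D.apartmentAct (x * y)⁻¹ v) = σ.1 (D.apartmentAct y⁻¹ (D.apartmentAct x⁻¹ v))
    rw [mul_inv_rev, apartmentAct_mul])
  { toFun := fun x =>
      { toFun := f x
        invFun := f x⁻¹
        left_inv := fun σ => by rw [← hfm, inv_mul_cancel, hf1]
        right_inv := fun σ => by rw [← hfm, mul_inv_cancel, hf1] }
    map_one' := Equiv.ext hf1
    map_mul' := fun x y => Equiv.ext (hfm x y) }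

lemma halfAct_apply (x : D.IwahoriWeyl) (σ : D.HalfApartment) (v : D.Apartment) :
    (D.halfAct x σ).1 v = σ.1 (D.apartmentAct x⁻¹ v) := rfl

lemma halfAct_half (x : D.IwahoriWeyl) (i : ι) (k : ℤ) : D.halfAct x (D.half i k) =
    D.half (D.idxW x.right i) (k + D.relRoot (D.idxW x.right i) x.left.toAdd) :=
  Subtype.ext (funext fun v => by
    change SignType.sign (D.affRoot i k (D.apartmentAct x⁻¹ v)) = SignType.sign _
    rw [← D.affRoot_apartmentAct x, apartmentAct_apartmentAct_inv])

/-- The opposite half-apartment. -/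
def halfNeg (σ : D.HalfApartment) : D.HalfApartment :=
  ⟨fun v => -σ.1 v, by
    obtain ⟨i, k, rfl⟩ := D.exists_eq_half σ
    obtain ⟨j, hj, -⟩ := D.exists_neg_affRoot i k
    exact ⟨j, -k, funext fun v => by rw [hj, Left.sign_neg]; rfl⟩⟩

lemma exists_halfRefl (σ : D.HalfApartment) :
    ∃ r, ∃ i k, σ = D.half i k ∧ D.IsReflection i k r := by
  obtain ⟨i, k, rfl⟩ := D.exists_eq_half σ
  obtain ⟨r, hr⟩ := D.exists_isReflection i k
  exact ⟨r, i, k, rfl, hr⟩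

/-- The affine reflection in the wall of a half-apartment. -/
def halfRefl (σ : D.HalfApartment) : D.IwahoriWeyl := (D.exists_halfRefl σ).choose

variable {D} in
lemma IsReflection.halfRefl_eq {i : ι} {k : ℤ} {r : D.IwahoriWeyl} (hr : D.IsReflection i k r) :
    D.halfRefl (D.half i k) = r := by
  obtain ⟨j, m, h, hr'⟩ := (D.exists_halfRefl (D.half i k)).choose_spec
  refine hr'.unique hr fun v hv => ?_
  rw [← sign_eq_zero_iff] at hv ⊢
  rw [D.half_eq_half_iff.1 h, hv]

lemma isReflection_halfRefl (i : ι) (k : ℤ) : D.IsReflection i k (D.halfRefl (D.half i k)) := by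
  obtain ⟨r, hr⟩ := D.exists_isReflection i k
  rwa [hr.halfRefl_eq]

lemma exists_halfNeg_half (i : ι) (k : ℤ) : ∃ j, D.halfNeg (D.half i k) = D.half j (-k) ∧
    (∀ v, D.affRoot j (-k) v = -D.affRoot i k v) ∧
    D.halfRefl (D.half j (-k)) = D.halfRefl (D.half i k) := by
  obtain ⟨j, hj, hj'⟩ := D.exists_neg_affRoot i k
  refine ⟨j, Subtype.ext (funext fun v => ?_), hj,
    (hj' _ (D.isReflection_halfRefl i k)).halfRefl_eq⟩
  change -SignType.sign (D.affRoot i k v) = SignType.sign (D.affRoot j (-k) v)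
  rw [hj, Left.sign_neg]

/-- A point of the base alcove. -/
def basePoint : D.Apartment := D.alcove_nonempty.some

lemma basePoint_mem : D.basePoint ∈ D.alcove := D.alcove_nonempty.some_mem

/-- A half-apartment is positive if it contains the base alcove. -/
def HalfPos (σ : D.HalfApartment) : Prop := σ.1 D.basePoint = 1

lemma halfPos_half (i : ι) (k : ℤ) : D.HalfPos (D.half i k) ↔ 0 < D.affRoot i k D.basePoint :=
  sign_eq_one_iff

lemma halfPos_halfAct_inv (x : D.IwahoriWeyl) (i : ι) (k : ℤ) :
    D.HalfPos (D.halfAct x⁻¹ (D.half i k)) ↔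
      0 < D.affRoot i k (D.apartmentAct x D.basePoint) := by
  rw [HalfPos, halfAct_apply, inv_inv]
  exact sign_eq_one_iff

lemma affRoot_apartmentAct_basePoint_ne_zero (x : D.IwahoriWeyl) (i : ι) (k : ℤ) :
    D.affRoot i k (D.apartmentAct x D.basePoint) ≠ 0 := by
  rw [← D.affRoot_apartmentAct x⁻¹, apartmentAct_inv_apartmentAct]
  exact D.affRoot_ne_zero_of_mem_alcove D.basePoint_mem _ _

/-- Positive half-apartments with the same wall are equal. -/
lemma half_eq_half_of_hyperplane_eq {i j : ι} {k m : ℤ} (hi : 0 < D.affRoot i k D.basePoint)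
    (hj : 0 < D.affRoot j m D.basePoint) (h : D.hyperplane i k = D.hyperplane j m) :
    D.half i k = D.half j m := by
  obtain ⟨c, hc⟩ := D.exists_affRoot_eq_mul (i := i) (k := k) (j := j) (m := m) fun v hv => by
    rwa [← mem_hyperplane_iff, ← h, mem_hyperplane_iff]
  rw [hc] at hj
  have hc0 : 0 < c := pos_of_mul_pos_left hj hi.le
  rw [half_eq_half_iff]
  intro v
  rw [hc, sign_mul, sign_pos hc0, one_mul]

/-- The positive half-apartments bounded by a wall of the base alcove. -/
def simpleHalf : Set D.HalfApartment := {σ | D.HalfPos σ ∧ ∃ i k, σ = D.half i k ∧ D.IsWall i k}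

lemma eq_of_mem_simpleHalf {σ τ : D.HalfApartment} (hσ : σ ∈ D.simpleHalf) (hτ : D.HalfPos τ)
    (h : ¬ D.HalfPos (D.halfAct (D.halfRefl σ) τ)) : τ = σ := by
  obtain ⟨hσ, i, k, rfl, v, hv, hva, hwall⟩ := hσ
  obtain ⟨j, m, rfl⟩ := D.exists_eq_half τ
  have hr := D.isReflection_halfRefl i k
  set r := D.halfRefl (D.half i k)
  have hinv : r⁻¹ = r := inv_eq_of_mul_eq_one_left hr.mul_self
  rw [← hinv, halfPos_halfAct_inv] at h
  rw [halfPos_half] at hσ hτ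
  refine D.half_eq_half_of_hyperplane_eq hτ hσ (hwall j m ?_)
  -- otherwise the base alcove and its reflection lie on the side of `v`, which `r` fixes
  rw [mem_hyperplane_iff] at hv ⊢
  by_contra hne
  have hfix : D.apartmentAct r v = v := by rw [hr.apartmentAct, hv, zero_smul, sub_zero]
  have hrinv : ∀ u, D.apartmentAct r (D.apartmentAct r u) = u := fun u => by
    rw [← apartmentAct_mul, hr.mul_self, apartmentAct_one]
  have h1 := D.sign_affRoot_eq_of_mem_closedAlcove hva D.basePoint_mem j m hne
  have e : ∀ u, D.affRoot (D.idxW r.right j) (m + D.relRoot (D.idxW r.right j) r.left.toAdd) u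
      = D.affRoot j m (D.apartmentAct r u) := fun u => by
    rw [← D.affRoot_apartmentAct r j m, hrinv]
  have h2 := D.sign_affRoot_eq_of_mem_closedAlcove hva D.basePoint_mem (D.idxW r.right j)
    (m + D.relRoot (D.idxW r.right j) r.left.toAdd) (by rwa [e, hfix])
  rw [e, e, hfix, h1, sign_pos hτ, eq_comm, sign_eq_one_iff] at h2
  exact h h2

/-- The action of the Iwahori-Weyl group on the half-apartments. -/
def rootAction : RootAction D.IwahoriWeyl D.HalfApartment where
  act := D.halfAct
  neg := D.halfNeg
  Pos := D.HalfPos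
  refl := D.halfRefl
  simple := D.simpleHalf
  act_neg _ _ := rfl
  pos_neg σ := by
    obtain ⟨i, k, rfl⟩ := D.exists_eq_half σ
    obtain ⟨j, h, hj, -⟩ := D.exists_halfNeg_half i k
    rw [h, halfPos_half, halfPos_half, hj, neg_pos, not_lt]
    exact (D.affRoot_ne_zero_of_mem_alcove D.basePoint_mem i k).le_iff_lt.symm
  refl_neg σ := by
    obtain ⟨i, k, rfl⟩ := D.exists_eq_half σ
    obtain ⟨j, h, -, hj⟩ := D.exists_halfNeg_half i k
    rw [h, hj]
  refl_mul_self σ := by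
    obtain ⟨i, k, rfl⟩ := D.exists_eq_half σ
    exact (D.isReflection_halfRefl i k).mul_self
  refl_act_self σ := by
    obtain ⟨i, k, rfl⟩ := D.exists_eq_half σ
    have hr := D.isReflection_halfRefl i k
    refine Subtype.ext (funext fun v => ?_)
    rw [halfAct_apply, inv_eq_of_mul_eq_one_left hr.mul_self]
    change SignType.sign (D.affRoot i k _) = -SignType.sign (D.affRoot i k v)
    rw [hr.affRoot_apartmentAct, relRoot_relCoroot_self, ← Left.sign_neg]
    congr 1
    push_cast
    ring
  refl_act x σ := by
    obtain ⟨i, k, rfl⟩ := D.exists_eq_half σ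
    rw [halfAct_half]
    exact ((D.isReflection_halfRefl i k).conj x).halfRefl_eq
  finite_inversions x := by
    refine ((D.finite_separating D.basePoint (D.apartmentAct x D.basePoint)).image
      fun a => D.half a.1 a.2).subset ?_
    rintro σ ⟨h1, h2⟩
    obtain ⟨i, k, rfl⟩ := D.exists_eq_half σ
    rw [halfPos_half] at h1
    rw [halfPos_halfAct_inv, not_lt] at h2
    exact ⟨(i, k), ⟨h1, h2⟩, rfl⟩
  not_pos_act_refl σ τ x hσ hτ h hσx hτx := by
    obtain ⟨i, k, rfl⟩ := D.exists_eq_half σ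
    obtain ⟨j, m, rfl⟩ := D.exists_eq_half τ
    have hr := D.isReflection_halfRefl i k
    set r := D.halfRefl (D.half i k)
    have hinv : r⁻¹ = r := inv_eq_of_mul_eq_one_left hr.mul_self
    rw [← hinv, halfPos_halfAct_inv, hr.affRoot_apartmentAct, not_lt] at h
    have hcomp : D.halfAct x⁻¹ (D.halfAct r (D.half j m)) =
        D.halfAct (r * x)⁻¹ (D.half j m) := by
      rw [mul_inv_rev, hinv, map_mul, Equiv.Perm.mul_apply]
    rw [hcomp, halfPos_halfAct_inv, apartmentAct_mul, hr.affRoot_apartmentAct, not_lt]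
    rw [halfPos_half] at hσ hτ
    rw [halfPos_halfAct_inv] at hσx hτx
    rw [not_lt] at hτx
    have hc : (0 : ℝ) < D.relRoot j (D.relCoroot i) :=
      pos_of_mul_pos_left (by linarith) hσ.le
    have := mul_pos hc hσx
    linarith
  simple_pos _ hσ := hσ.1
  eq_of_simple _ hσ _ hτ h := D.eq_of_mem_simpleHalf hσ hτ h
  exists_simple σ x hσ hσx := by
    obtain ⟨i, k, rfl⟩ := D.exists_eq_half σ
    rw [halfPos_half] at hσ
    rw [halfPos_halfAct_inv, not_lt] at hσx
    obtain ⟨j, m, hjm, h1, h2⟩ := D.exists_isWall D.basePoint_mem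
      (D.affRoot_apartmentAct_basePoint_ne_zero x) hσ
      (lt_of_le_of_ne hσx (D.affRoot_apartmentAct_basePoint_ne_zero x i k))
    refine ⟨D.half j m, ⟨(D.halfPos_half j m).2 h1, j, m, rfl, hjm⟩, ?_⟩
    rw [halfPos_halfAct_inv, not_lt]
    exact h2.le

/-! ### Length and Bruhat order -/

lemma simpleReflections_eq : D.simpleReflections = D.rootAction.refl '' D.rootAction.simple := by
  ext s
  constructor
  · rintro ⟨i, k, hw, hs⟩
    rcases (D.affRoot_ne_zero_of_mem_alcove D.basePoint_mem i k).lt_or_gt with h | h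
    · obtain ⟨j, hj, hj'⟩ := D.exists_neg_affRoot i k
      refine ⟨D.half j (-k), ⟨?_, j, -k, rfl, ?_⟩, (hj' s hs).halfRefl_eq⟩
      · rw [halfPos_half, hj]
        linarith
      · have hh : D.hyperplane j (-k) = D.hyperplane i k := by
          ext v
          rw [mem_hyperplane_iff, mem_hyperplane_iff, hj, neg_eq_zero]
        rwa [IsWall, hh]
    · exact ⟨D.half i k, ⟨(D.halfPos_half i k).2 h, i, k, rfl, hw⟩, hs.halfRefl_eq⟩
  · rintro ⟨σ, ⟨-, i, k, rfl, hw⟩, rfl⟩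
    exact ⟨i, k, hw, D.isReflection_halfRefl i k⟩

/-- The elements preserving the base alcove are those which preserve positivity. -/
lemma mem_Ω_iff (τ : D.IwahoriWeyl) : τ ∈ D.Ω ↔ D.rootAction.len τ = 0 := by
  have key : D.rootAction.len τ = 0 ↔ ∀ i k, 0 < D.affRoot i k D.basePoint →
      0 < D.affRoot i k (D.apartmentAct τ D.basePoint) := by
    rw [RootAction.len, RootAction.inversions, Set.ncard_eq_zero (D.rootAction.finite_inversions τ),
      Set.eq_empty_iff_forall_notMem]
    constructor
    · intro h i k hik
      by_contra hc
      exact h (D.half i k) ⟨(D.halfPos_half i k).2 hik,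
        fun h' => hc ((D.halfPos_halfAct_inv τ i k).1 h')⟩
    · rintro h σ ⟨h1, h2⟩
      obtain ⟨i, k, rfl⟩ := D.exists_eq_half σ
      exact h2 ((D.halfPos_halfAct_inv τ i k).2 (h i k ((D.halfPos_half i k).1 h1)))
  rw [key]
  constructor
  · intro h i k hik
    have hmem : D.apartmentAct τ D.basePoint ∈ D.alcove := by
      have h' : D.apartmentAct τ '' D.alcove = D.alcove := h
      rw [← h']
      exact ⟨_, D.basePoint_mem, rfl⟩
    rwa [← sign_eq_one_iff, D.sign_affRoot_eq_of_mem_alcove hmem D.basePoint_mem, sign_eq_one_iff]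
  · intro h
    have hmem : D.apartmentAct τ D.basePoint ∈ D.alcove := by
      refine D.mem_alcove_of_sign_affRoot_eq D.basePoint_mem fun i k => ?_
      rcases (D.affRoot_ne_zero_of_mem_alcove D.basePoint_mem i k).lt_or_gt with h0 | h0
      · obtain ⟨j, hj, -⟩ := D.exists_neg_affRoot i k
        have h1 := h j (-k) (by rw [hj]; linarith)
        rw [hj, neg_pos] at h1
        rw [sign_neg h0, sign_neg h1]
      · rw [sign_pos h0, sign_pos (h i k h0)]
    -- an element moving one point of the alcove into the alcove maps the alcove into itself
    have hmaps : ∀ x, D.apartmentAct x D.basePoint ∈ D.alcove →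
        ∀ v ∈ D.alcove, D.apartmentAct x v ∈ D.alcove := by
      intro x hx v hv
      refine D.mem_alcove_of_sign_affRoot_eq hx fun i k => ?_
      rw [← D.affRoot_apartmentAct x⁻¹, apartmentAct_inv_apartmentAct,
        ← D.affRoot_apartmentAct x⁻¹ i k (D.apartmentAct x D.basePoint),
        apartmentAct_inv_apartmentAct, D.sign_affRoot_eq_of_mem_alcove hv D.basePoint_mem]
    have hinv : D.apartmentAct τ⁻¹ D.basePoint ∈ D.alcove := by
      refine D.mem_alcove_of_sign_affRoot_eq D.basePoint_mem fun i k => ?_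
      rw [← D.affRoot_apartmentAct τ, apartmentAct_apartmentAct_inv,
        ← D.sign_affRoot_eq_of_mem_alcove hmem D.basePoint_mem, D.affRoot_apartmentAct τ]
    refine Set.Subset.antisymm ?_ fun v hv => ?_
    · rintro _ ⟨v, hv, rfl⟩
      exact hmaps τ hmem v hv
    · exact ⟨_, hmaps τ⁻¹ hinv v hv, D.apartmentAct_apartmentAct_inv τ v⟩

/-- The length is the number of hyperplanes separating the base alcove from its image. -/
lemma length_eq_len (x : D.IwahoriWeyl) : D.length x = D.rootAction.len x := by
  rw [← D.rootAction.sInf_length_eq_len, length, simpleReflections_eq]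
  simp only [mem_Ω_iff]

lemma bruhatLE_iff (x y : D.IwahoriWeyl) : D.BruhatLE x y ↔ D.rootAction.Le x y := by
  have h : (fun x y : D.IwahoriWeyl =>
      (∃ r i k, D.IsReflection i k r ∧ y = r * x) ∧ D.length x < D.length y) =
      D.rootAction.Step := by
    ext x y
    rw [RootAction.step_iff, length_eq_len, length_eq_len]
    refine and_congr_left fun _ => ⟨?_, ?_⟩
    · rintro ⟨r, i, k, hr, rfl⟩
      exact ⟨D.half i k, congrArg (· * x) hr.halfRefl_eq.symm⟩
    · rintro ⟨σ, rfl⟩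
      obtain ⟨i, k, rfl⟩ := D.exists_eq_half σ
      exact ⟨_, i, k, D.isReflection_halfRefl i k, rfl⟩
  rw [BruhatLE, RootAction.Le, h]

end QuasiSplitRootDatum

namespace QuasiSplitRootDatum

variable {ι X Y Γ : Type*} [AddCommGroup X] [AddCommGroup Y] [Group Γ]
  (D : QuasiSplitRootDatum ι X Y Γ)

/-! ### Translations -/

lemma mul_t_mul_inv (x : D.IwahoriWeyl) (y : D.Coinv) :
    x * D.t y * x⁻¹ = D.t (D.weylAct x.right y) := by
  rw [mul_inv_eq_iff_eq_mul]
  refine SemidirectProduct.ext (Multiplicative.toAdd.injective ?_) ?_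
  · rw [mul_left_toAdd, mul_left_toAdd]
    change x.left.toAdd + _ = D.weylAct x.right y + D.weylAct 1 x.left.toAdd
    rw [map_one, add_comm]
    rfl
  · change x.right * 1 = 1 * x.right
    rw [mul_one, one_mul]

lemma apartmentAct_t (y : D.Coinv) (v : D.Apartment) :
    D.apartmentAct (D.t y) v = v + D.emb y := by
  rw [apartmentAct_eq]
  change D.linAct 1 v + _ = _
  rw [linAct_one]
  rfl

variable [Finite ι]

/-- An affine root which is positive on the base alcove and bounds it along a wall takes values less
than `1` on the alcove. -/
lemma affRoot_lt_one_of_isWall {i : ι} {k : ℤ} (h : D.IsWall i k) :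
    D.affRoot i k D.basePoint < 1 := by
  obtain ⟨v, hv, hva, -⟩ := h
  rw [mem_hyperplane_iff, affRoot_apply] at hv
  have hneg : D.affRoot i (k + 1) v < 0 := by
    rw [affRoot_apply]
    push_cast
    linarith
  have h1 := D.sign_affRoot_eq_of_mem_closedAlcove hva D.basePoint_mem i (k + 1) hneg.ne
  rw [sign_neg hneg, eq_comm, sign_eq_neg_one_iff, affRoot_apply] at h1
  rw [affRoot_apply]
  push_cast at h1
  linarith

/-- A translation is `J`-dominant if its translation vector is nonnegative on the gradients of the
affine roots bounding the base alcove along the walls in `J`. -/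
lemma jDominant_t {J : Set D.IwahoriWeyl} {y : D.Coinv}
    (h : ∀ i k, 0 < D.affRoot i k D.basePoint → D.halfRefl (D.half i k) ∈ J → 0 ≤ D.relRoot i y) :
    D.rootAction.JDominant J (D.t y) := by
  rintro σ ⟨hσ, i, k, rfl, hwall⟩ hJ
  have hpos := (D.halfPos_half i k).1 hσ
  rcases (h i k hpos hJ).eq_or_lt with h0 | h0
  · left
    have hr := D.isReflection_halfRefl i k
    have hr' : D.IsReflection i k (D.t y * D.halfRefl (D.half i k) * (D.t y)⁻¹) := by
      have hidx : D.idxW (D.t y).right i = i := by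
        change D.idxW 1 i = i
        rw [idxW, OneMemClass.coe_one, map_one, Equiv.Perm.one_apply]
      have hl : (D.t y).left.toAdd = y := rfl
      have := hr.conj (D.t y)
      rwa [hidx, hl, ← h0, add_zero] at this
    exact mul_inv_eq_iff_eq_mul.1 (hr'.unique hr fun _ hv => hv)
  · right
    -- `t` moves the base alcove across the hyperplane `t σ`
    have hnot : ¬ D.rootAction.Pos (D.rootAction.act (D.t y) (D.half i k)) := by
      change ¬ D.HalfPos (D.halfAct (D.t y) (D.half i k))
      have hlt := D.affRoot_lt_one_of_isWall hwall
      rw [← inv_inv (D.t y), halfPos_halfAct_inv, not_lt]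
      have e : D.affRoot i k D.basePoint =
          D.affRoot i k (D.apartmentAct (D.t y)⁻¹ D.basePoint) + D.relRoot i y := by
        conv_lhs => rw [← D.apartmentAct_apartmentAct_inv (D.t y) D.basePoint, apartmentAct_t,
          affRoot_apply, map_add, realRoot_emb]
        rw [affRoot_apply]
        ring
      have h1 : (1 : ℝ) ≤ D.relRoot i y := by exact_mod_cast h0
      linarith
    have hrefl : D.rootAction.refl (D.rootAction.neg (D.rootAction.act (D.t y) (D.half i k))) *
        D.t y = D.t y * D.rootAction.refl (D.half i k) := by
      rw [D.rootAction.refl_neg, D.rootAction.refl_act, inv_mul_cancel_right]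
    rw [D.rootAction.step_iff, ← hrefl]
    refine ⟨⟨_, (D.rootAction.refl_mul_cancel _ _).symm⟩, ?_⟩
    refine (D.rootAction.len_refl_mul_lt_iff _ ((D.rootAction.pos_neg _).2 hnot)).2 ?_
    rw [D.rootAction.act_neg, D.rootAction.act_inv_act, D.rootAction.pos_neg]
    exact not_not_intro hσ

/-- If `W_J` is finite, then each translation is conjugate under `W_J` to a `J`-dominant one. -/
lemma exists_jDominant_t {J : Set D.IwahoriWeyl} (hfin : Finite (D.parabolic J)) (y : D.Coinv) :
    ∃ c ∈ D.parabolic J, D.rootAction.JDominant J (D.t (D.weylAct c.right y)) := by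
  let _ := Fintype.ofFinite (D.parabolic J)
  -- a positive multiple of the vector from the barycenter of the orbit of `basePoint` under `W_J`,
  -- which is fixed by `W_J`, to `basePoint`
  let q : D.Apartment := ∑ u : D.parabolic J, (D.basePoint - D.apartmentAct u D.basePoint)
  obtain ⟨c, hc⟩ := Finite.exists_max fun u : D.parabolic J =>
    D.form q (D.emb (D.weylAct (u : D.IwahoriWeyl).right y))
  refine ⟨c, c.2, D.jDominant_t fun i k hpos hJ => ?_⟩
  have hr := D.isReflection_halfRefl i k
  let r : D.parabolic J := ⟨D.halfRefl (D.half i k), Subgroup.subset_closure hJ⟩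
  have hsum : ∑ u : D.parabolic J, D.affRoot i k (D.apartmentAct u D.basePoint) = 0 := by
    have h1 : ∑ u : D.parabolic J, D.affRoot i k (D.apartmentAct u D.basePoint) =
        ∑ u : D.parabolic J, -D.affRoot i k (D.apartmentAct u D.basePoint) := by
      refine (Fintype.sum_equiv (Equiv.mulLeft r) _ _ fun u => ?_).symm
      change _ = D.affRoot i k (D.apartmentAct (D.halfRefl (D.half i k) * u) D.basePoint)
      rw [apartmentAct_mul, hr.affRoot_apartmentAct, relRoot_relCoroot_self]
      push_cast
      ring
    rw [Finset.sum_neg_distrib] at h1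
    linarith
  have hq : 0 < D.realRoot i q := by
    have e : D.realRoot i q = ∑ u : D.parabolic J, D.affRoot i k D.basePoint := by
      rw [← sub_zero (∑ u : D.parabolic J, D.affRoot i k D.basePoint), ← hsum,
        ← Finset.sum_sub_distrib, map_sum]
      refine Finset.sum_congr rfl fun u _ => ?_
      rw [affRoot_apply, affRoot_apply, map_sub]
      ring
    rw [e]
    exact Finset.sum_pos (fun _ _ => hpos) ⟨1, Finset.mem_univ _⟩
  have hmax := hc (r * c)
  have e : D.emb (D.weylAct ((r * c : D.parabolic J) : D.IwahoriWeyl).right y) =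
      D.emb (D.weylAct (c : D.IwahoriWeyl).right y) -
        (D.relRoot i (D.weylAct (c : D.IwahoriWeyl).right y) : ℝ) • D.emb (D.relCoroot i) := by
    change D.emb (D.weylAct ((D.halfRefl (D.half i k)).right * (c : D.IwahoriWeyl).right) y) = _
    rw [weylAct_mul_apply, hr.2, ← emb_zsmul]
    exact TensorProduct.tmul_sub _ _ _
  simp only [e, form_sub_right, form_smul_right] at hmax
  have h2 := D.two_mul_form_relCoroot i q
  have h3 : 0 < D.form q (D.emb (D.relCoroot i)) := by
    rw [form_comm]
    have := mul_pos hq (D.form_relCoroot_self_pos i)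
    linarith
  have h4 : (0 : ℝ) ≤ D.relRoot i (D.weylAct (c : D.IwahoriWeyl).right y) :=
    nonneg_of_mul_nonneg_left (by linarith) h3
  exact_mod_cast h4

end QuasiSplitRootDatum

end

theorem mainTheorem6 {ι X Y Γ : Type*} [Finite ι] [AddCommGroup X] [AddCommGroup Y]
    [Module.Finite ℤ X] [Module.Finite ℤ Y] [Group Γ]
    (D : QuasiSplitRootDatum ι X Y Γ)
    (μ : Y) (hμ : D.IsDominant μ)
    (J : Set D.IwahoriWeyl) (hJ : J ⊆ D.simpleReflections) (hfin : Finite (D.parabolic J)) :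
    D.minReps J ∩ D.AdmJ J μ = D.minReps J ∩ D.Adm μ := by
  refine Set.Subset.antisymm ?_ ?_
  · rintro w ⟨hw, hwJ⟩
    refine ⟨hw, ?_⟩
    obtain ⟨_, ⟨u, hu, y, ⟨x, hy⟩, rfl⟩, v, hv, rfl⟩ := hwJ
    obtain ⟨c, hc, ht⟩ := D.exists_jDominant_t hfin (D.weylAct x (D.toCoinv μ))
    rw [← D.mul_t_mul_inv] at ht
    refine ⟨c.right * x, ?_⟩
    rw [D.weylAct_mul_apply, ← D.mul_t_mul_inv]
    rw [D.bruhatLE_iff] at hy ⊢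
    rw [D.simpleReflections_eq] at hJ
    refine D.rootAction.le_of_mem_double_coset hJ (c := c) ht hc hu hv ?_
      (y := y) ?_ rfl
    · intro s hs hsJ
      have hle := hw _ (Subgroup.subset_closure hsJ)
      rw [D.length_eq_len, D.length_eq_len] at hle
      exact (D.rootAction.step_refl_mul_or (D.rootAction.simple_pos s hs) _).resolve_right
        fun h => hle.not_gt ((D.rootAction.step_iff _ _).1 h).2
    · rwa [mul_assoc c, inv_mul_cancel_left, inv_mul_cancel_right]
  · rintro w ⟨hw, hwA⟩
    exact ⟨hw, w, ⟨1, one_mem _, w, hwA, one_mul w⟩, 1, one_mem _, mul_one w⟩
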